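/- **Setting.** There are $n$ bidders and $m$ items. Bidder $i$ has a valuation function $v_i:\mathbb R^d\times 2^{[m]}\to\mathbb R_{\ge 0}$ that is $\mathcal L$-Lipschitz in the type: $|v_i(t,S)-v_i(t',S)|\le\mathcal L\|t-t'\|_\infty$ for all $t,t',S$. Valuations are normalized: $v_i(0,S)=0$ for every bundle $S$ and $v_i(t,\emptyset)=0$ for every type $t$. Let $A\in\mathbb R^{d\times k}$ be a design matrix, $\|A\|_\infty=\max_{a,b}|A_{ab}|$, and let $v_i^A(z,S)=v_i(Az,S)$ for latent types $z\in\mathbb R^k$. Fix $p\in[1,\infty]$ (with $1/\infty=0$), and let $\pi_p$ be the Prokhorov distance between probability measures on $\mathbb R^k$ with respect to the $\ell_p$ distance. A mechanism $\mathcal M$ maps a profile $b=(b_1,\dots,b_n)$ of reported latent types to a (possibly random) outcome: an allocation, i.e. a bundle for each bidder, and nonnegative payments. Let $u_i(z_i,\mathcal M(b))$ be the expected value $v_i^A(z_i,\cdot)$ of the bundle of bidder $i$ minus her expected payment, the expectation being over the randomness of the mechanism. For a product distribution $F=\times_i F_i$: * $\mathcal M$ is individually rational (IR) if $u_i(z_i,\mathcal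 M(z))\ge 0$ for all profiles $z$ of types and all $i$. * $\mathcal M$ is BIC w.r.t. $F$ if $\mathbb E_{z_{-i}\sim F_{-i}}[u_i(z_i,\mathcal M(z_i,z_{-i}))]\ge\mathbb E_{z_{-i}\sim F_{-i}}[u_i(z_i,\mathcal M(z_i',z_{-i}))]$ for all $i$ and all $z_i,z_i'\in\mathrm{supp}(F_i)$. * $\mathcal M$ is $(\eta,\mu)$-BIC w.r.t. $F$ if for every $i$ and every misreport $z_i'$, $$\Pr_{z_i\sim F_i}\Big[\mathbb E_{z_{-i}\sim F_{-i}}[u_i(z_i,\mathcal M(z_i,z_{-i}))]\ge\mathbb E_{z_{-i}\sim F_{-i}}[u_i(z_i,\mathcal M(z_i',z_{-i}))]-\eta\Big]\ge 1-\mu .$$ * $Rev(\mathcal M,F)$ is the expected total payment under truthful reports $z\sim F$. Query access to $\hat{\mathcal M}$ means access to an oracle that, on a profile $b$, returns a realized allocation and the payments of $\hat{\mathcal M}(b)$. Oracle access to $\hat F_z=\times_i\hat F_{z,i}$ means access, for every $i$, to (1) a sampler that, given $x,\beta\in\mathbb R^k$, draws from $\hat F_{z,i}$ conditioned on the box $\prod_j[x_j,x_j+\beta_j)$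 (its answer is unspecified if the box has probability $0$), and (2) an oracle that, given $x\in\mathbb R^k$, returns a point of $\mathrm{supp}(\hat F_{z,i})$ closest to $x$ in $\ell_p$ distance. **Lemma.** There is an absolute constant $C>0$ such that the following holds for all $n,m,d,k$, $p$, $A$, $\mathcal L\ge 0$, $\zeta_p\ge 0$ and $\delta>0$. There is a randomized algorithm, depending only on these parameters, that takes a profile of reported latent types, uses query access to $\hat{\mathcal M}$ and oracle access to $\hat F_z$, and outputs an allocation and payments, with the following property. Let $v_1,\dots,v_n$ be valuations as above, let $\hat F_{z,1},\dots,\hat F_{z,n}$ be probability measures on $\mathbb R^k$ with $\mathrm{supp}(\hat F_{z,i})\subseteq[0,1]^k$, let $\hat{\mathcal M}$ be a mechanism, with possibly random allocation and with payments determined by the reports, that is BIC w.r.t. $\hat F_z$ and IR on all profiles from the supports of the $\hat F_{z,i}$ (for the valuations $v_i^A$), and let $F_z=\times_i F_{z,i}$ be any product of probability measures on $\mathbb R^k$ with $\pi_p(F_{z,i},\hat F_{z,i})\le\zeta_p$ for all $i$. Then the mechanism $\widetilde{\mathcal M}$ that the algorithm implements satisfies, with $$\mu=C\,(\zeta_p+\delta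 k^{1/p}),\qquad \eta=C\,k\,\mathcal L\,\|A\|_\infty\Big(\delta+n\Big(1+\frac{k^{1-1/p}}{\delta}\Big)\zeta_p\Big):$$ 1. $\widetilde{\mathcal M}$ is IR on all profiles of types in $\mathbb R^k$, and it is $(\eta,\mu)$-BIC w.r.t. $F_z$, for misreports in $\mathbb R^k$; 2. $Rev(\widetilde{\mathcal M},F_z)\ge Rev(\hat{\mathcal M},\hat F_z)-C\,n\,\eta$; 3. $\widetilde{\mathcal M}$ satisfies every downward-closed constraint on allocations that $\hat{\mathcal M}$ satisfies (for instance, that every item goes to at most one bidder). -/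

import Mathlib

open MeasureTheory ProbabilityTheory
open scoped NNReal ENNReal

namespace LatentMechanism

noncomputable section

/-- The latent space `ℝ^k` with the `ℓ_p` distance. -/
abbrev Latent (p : ℝ≥0∞) (k : ℕ) : Type := PiLp p (fun _ : Fin k => ℝ)

/-- An allocation gives each of the `n` bidders a bundle, that is, a subset of the `m` items. -/
abbrev Allocation (n m : ℕ) : Type := Fin n → Set (Fin m)

/-- A realized outcome: an allocation, and the nonnegative amount that each bidder pays. -/
abbrev Outcome (n m : ℕ) : Type := Allocation n m × (Fin n → ℝ≥0)

/-- A direct mechanism for `n` bidders with types in `Θ`: it maps a profile of reported types to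
a random outcome.  (It is used together with `IsMarkovKernel`.) -/
abbrev Mechanism (n m : ℕ) (Θ : Type) [MeasurableSpace Θ] : Type :=
  Kernel (Fin n → Θ) (Outcome n m)

section Mechanisms

variable {n m : ℕ} {Θ : Type} [MeasurableSpace Θ]

/-- The payments are given by a payment rule: they are determined by the reports.  The allocation
may still be random. -/
def HasPaymentRule (M : Mechanism n m Θ) : Prop :=
  ∀ b, ∃ q : Fin n → ℝ≥0, ∀ᵐ o ∂(M b), o.2 = q

/-- `u_i(t, M(b))`: expected quasi-linear utility of bidder `i` of type `t` under reports `b`;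
`w` is her valuation function. -/
def utility (M : Mechanism n m Θ) (w : Θ → Set (Fin m) → ℝ≥0) (i : Fin n) (t : Θ)
    (b : Fin n → Θ) : ℝ :=
  ∫ o, ((w t (o.1 i) : ℝ) - (o.2 i : ℝ)) ∂(M b)

/-- Expected utility of bidder `i` of type `t` who reports `r`, when the other bidders report
their types truthfully, independently drawn from the `F j`, `j ≠ i`.  (The `i`-th coordinate of
the drawn profile is overwritten by the report `r`.) -/
def interimUtility (M : Mechanism n m Θ) (w : Fin n → Θ → Set (Fin m) → ℝ≥0)
    (F : Fin n → Measure Θ) (i : Fin n) (t r : Θ) : ℝ :=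
  ∫ s, utility M (w i) i t (Function.update s i r) ∂(Measure.pi F)

/-- Ex-post individual rationality on all profiles of types from the sets `T i`. -/
def IsIR (M : Mechanism n m Θ) (w : Fin n → Θ → Set (Fin m) → ℝ≥0) (T : Fin n → Set Θ) : Prop :=
  ∀ b : Fin n → Θ, (∀ i, b i ∈ T i) → ∀ i,
    Integrable (fun o : Outcome n m => (o.2 i : ℝ)) (M b) ∧ 0 ≤ utility M (w i) i (b i) b

/-- Bayesian incentive compatibility with respect to the product of the `F i`; the types of
bidder `i` are the points of the support of `F i`. -/
def IsBIC [TopologicalSpace Θ] (M : Mechanism n m Θ) (w : Fin n → Θ → Set (Fin m) → ℝ≥0)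
    (F : Fin n → Measure Θ) : Prop :=
  ∀ i, ∀ t ∈ (F i).support, ∀ r ∈ (F i).support,
    interimUtility M w F i t r ≤ interimUtility M w F i t t

/-- `(η, μ)`-Bayesian incentive compatibility with respect to the product of the `F i`: for every
misreport `r`, with probability at least `1 - μ` over the type of bidder `i`, misreporting `r`
gains her at most `η` in expectation. -/
def IsApproxBIC (M : Mechanism n m Θ) (w : Fin n → Θ → Set (Fin m) → ℝ≥0)
    (F : Fin n → Measure Θ) (η μ : ℝ) : Prop :=
  ∀ i, ∀ r : Θ,
    1 - μ ≤ (F i).real {t | interimUtility M w F i t r - η ≤ interimUtility M w F i t t}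

/-- Expected revenue under truthful reports drawn from the product of the `F i`. -/
def revenue (M : Mechanism n m Θ) (F : Fin n → Measure Θ) : ℝ≥0∞ :=
  ∫⁻ o, ((∑ i, o.2 i : ℝ≥0) : ℝ≥0∞) ∂((Measure.pi F).bind M)

end Mechanisms

/-- `‖A‖_∞`: the largest absolute value of an entry (`0` if there are no entries). -/
def maxEntry {d k : ℕ} (A : Matrix (Fin d) (Fin k) ℝ) : ℝ :=
  ⨆ e : Fin d × Fin k, |A e.1 e.2|

/-- `v` is `L`-Lipschitz in the type, in the sup norm, for every bundle. -/
def IsLipschitzValuation {d m : ℕ} (L : ℝ) (v : (Fin d → ℝ) → Set (Fin m) → ℝ≥0) : Prop :=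
  ∀ (t t' : Fin d → ℝ) (S : Set (Fin m)), |(v t S : ℝ) - (v t' S : ℝ)| ≤ L * ‖t - t'‖

/-- The valuation over latent types: `v^A(z, S) = v(A z, S)`. -/
def latentValuation {d k m : ℕ} (p : ℝ≥0∞) (A : Matrix (Fin d) (Fin k) ℝ)
    (v : (Fin d → ℝ) → Set (Fin m) → ℝ≥0) : Latent p k → Set (Fin m) → ℝ≥0 :=
  fun z S => v (A.mulVec (WithLp.ofLp z)) S

/-- The box `∏_j [x_j, x_j + β_j)`. -/
def box {p : ℝ≥0∞} {k : ℕ} (x : Latent p k) (β : Fin k → ℝ) : Set (Latent p k) :=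
  {y | ∀ j, x j ≤ y j ∧ y j < x j + β j}

/-- Oracle access to latent distributions `G i`.  The sampler `draw i` returns a sample of `G i`
conditioned on the queried box; on a box of probability zero its answer is unspecified.
The oracle `nearest i` returns a point of the support of `G i` that is closest to the queried
point in `ℓ_p` distance (ties are broken in an unspecified way). -/
structure LatentOracle {n k : ℕ} {p : ℝ≥0∞} [Fact (1 ≤ p)]
    (G : Fin n → Measure (Latent p k)) where
  draw : Fin n → Kernel (Latent p k × (Fin k → ℝ)) (Latent p k)
  draw_markov : ∀ i, IsMarkovKernel (draw i)
  draw_eq : ∀ i x β, G i (box x β) ≠ 0 → draw i (x, β) = cond (G i) (box x β)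
  nearest : Fin n → Latent p k → Latent p k
  nearest_measurable : ∀ i, Measurable (nearest i)
  nearest_mem : ∀ i x, nearest i x ∈ (G i).support
  nearest_le : ∀ i x, ∀ y ∈ (G i).support, dist x (nearest i x) ≤ dist x y

/-- Randomized programs with oracle access to a mechanism and to latent distributions.  A program
* ends with an outcome (allocation and payments), or
* draws a uniform point of `[0,1]^N` as internal randomness, or
* queries the mechanism at a profile of latent types and receives one realized outcome, or
* asks the sampler of each bidder `i` for one sample from the box at `x i` with sides `β i`, or
* asks, for each bidder `i`, for a support point closest to `x i`,
and in the last four cases continues depending on the answer. -/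
inductive OracleProgram (n m : ℕ) (p : ℝ≥0∞) (k : ℕ) : Type
  | output (o : Outcome n m) : OracleProgram n m p k
  | uniform (N : ℕ) (next : (Fin N → ℝ) → OracleProgram n m p k) : OracleProgram n m p k
  | query (b : Fin n → Latent p k) (next : Outcome n m → OracleProgram n m p k) :
      OracleProgram n m p k
  | draw (x : Fin n → Latent p k) (β : Fin n → Fin k → ℝ)
      (next : (Fin n → Latent p k) → OracleProgram n m p k) : OracleProgram n m p k
  | nearest (x : Fin n → Latent p k)
      (next : (Fin n → Latent p k) → OracleProgram n m p k) : OracleProgram n m p k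

/-- The distribution of the outcome of a program, for given oracles.  All oracle answers and all
internal random draws are independent.  (If the continuation of a random step is not measurable,
then `Measure.bind` is the zero measure, so that the result is a probability measure only if the
program is measurable along its execution.) -/
def OracleProgram.run {n m k : ℕ} {p : ℝ≥0∞} [Fact (1 ≤ p)] {G : Fin n → Measure (Latent p k)}
    (M : Mechanism n m (Latent p k)) (O : LatentOracle G) :
    OracleProgram n m p k → Measure (Outcome n m)
  | .output o => Measure.dirac o
  | .uniform N next =>
      ((volume : Measure (Fin N → ℝ)).restrict (Set.Icc 0 1)).bind fun u => run M O (next u)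
  | .query b next => (M b).bind fun o => run M O (next o)
  | .draw x β next =>
      (Measure.pi fun i => O.draw i (x i, β i)).bind fun y => run M O (next y)
  | .nearest x next => run M O (next fun i => O.nearest i (x i))

/-- The mechanism `Mt` is the one that, on every profile of reports, runs the program that `P`
assigns to these reports. -/
def IsImplementedBy {n m k : ℕ} {p : ℝ≥0∞} [Fact (1 ≤ p)] {G : Fin n → Measure (Latent p k)}
    (Mt : Mechanism n m (Latent p k)) (P : (Fin n → Latent p k) → OracleProgram n m p k)
    (M : Mechanism n m (Latent p k)) (O : LatentOracle G) : Prop :=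
  ∀ b, Mt b = (P b).run M O

end

end LatentMechanism

namespace LatentMechanism

noncomputable section

/-! ### Measure theory: Prokhorov comparison of means, and product measures with one factor changed.
-/

section MeasureLemmas

/-! The mechanism rounds each report to the nearest point of its support. It then shifts a grid of
side `δ` uniformly at random (one shift for all bidders) and replaces each rounded report by a fresh
sample of `Fhat i` conditioned on its cell. It queries `Mhat` at the sampled profile, lowers every
payment by `c` (truncated at zero), and drops each bidder whose report is farther than `τ = ζ + δ`
from the support.

Two facts about resampling carry the proof. First, drawing a point and redrawing it from its own
cell of a countable partition does not change its law, so for each fixed shift every `Fhat i` is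
preserved. Hence the product is preserved too (`bind_averaged_profileSampler_eq`). It stays a
product when one report is fixed, because then a single factor depends on the shift
(`bind_averaged_profileSampler_update_eq`). Second, the sample depends on a report only through the
cell of its rounding. The shift separates two points with probability at most twice their `ℓ_1`
distance over `δ`, so the mean of a bounded function of the sampled profile changes little when a
report moves, even if the function itself is irregular (`abs_integral_averaged_update_sub_le`).
Means of such smoothed functions can be compared across Prokhorov-close distributions, and replacing
the `n` factors one at a time gives an error of order `n H (1 + k^(1-1/p)/δ) ζ`, where `H = k L
‖A‖_∞` is the Lipschitz constant of the latent valuations (`abs_integral_update_sub_le`).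

Up to this error a bidder faces opponents drawn from `Fhat`, while her own entry is a support point
within `τ + δ` of her report in every coordinate. Exact BIC between support points, two changes of
type by `τ + δ`, and the discount together bound her gain by `3c` plus errors
(`cutInterim_le_cutInterim_add`, `interimUtility_robustMechanism_le`). The discount `c ≥ H (τ + δ)`
also covers the loss in value from moving her entry, which gives IR everywhere. By Prokhorov
closeness, a type lies farther than `τ` from the support with probability at most `τ`
(`measure_far_le`); this gives `μ`. Revenue loses only the transfer error, the discount, and the
payments of dropped bidders, which IR bounds by `H`. -/

theorem integral_bind_kernel {α β : Type*} {mα : MeasurableSpace α} {mβ : MeasurableSpace β}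
    {μ : Measure α} {κ : Kernel α β} {f : β → ℝ} (h : Integrable f (μ.bind κ)) :
    ∫ y, f y ∂(μ.bind κ) = ∫ x, ∫ y, f y ∂(κ x) ∂μ := by
  rw [Measure.comp_eq_comp_const_apply] at h ⊢
  rw [Kernel.integral_comp h]
  simp

theorem integrable_of_measurable_of_bounded {α : Type*} {mα : MeasurableSpace α} {μ : Measure α}
    [IsFiniteMeasure μ] {f : α → ℝ} (hf : Measurable f) {B : ℝ} (h : ∀ x, |f x| ≤ B) :
    Integrable f μ :=
  Integrable.of_bound hf.aestronglyMeasurable B (ae_of_all _ h)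

theorem abs_integral_le_of_bounded {α : Type*} {mα : MeasurableSpace α} {μ : Measure α}
    [IsProbabilityMeasure μ] {f : α → ℝ} {B : ℝ} (h : ∀ᵐ x ∂μ, |f x| ≤ B) :
    |∫ x, f x ∂μ| ≤ B := by
  simpa using norm_integral_le_of_norm_le_const (μ := μ) (f := f) (C := B) h

theorem measurable_integral_kernel {α β : Type*} {mα : MeasurableSpace α}
    {mβ : MeasurableSpace β} (κ : Kernel α β) [IsSFiniteKernel κ] {f : β → ℝ}
    (hf : Measurable f) : Measurable fun x => ∫ y, f y ∂(κ x) :=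
  (hf.stronglyMeasurable.integral_kernel (κ := κ)).measurable

theorem integral_le_integral_add_of_ae {α : Type*} {mα : MeasurableSpace α} {μ : Measure α}
    [IsProbabilityMeasure μ] {f g : α → ℝ} (hf : Integrable f μ) (hg : Integrable g μ) {c : ℝ}
    (h : ∀ᵐ x ∂μ, f x ≤ g x + c) : ∫ x, f x ∂μ ≤ ∫ x, g x ∂μ + c := by
  have := integral_mono_ae hf (hg.add (integrable_const c)) h
  simpa [integral_add hg (integrable_const c)] using this

/-- If `f x ≤ g y + c` for almost all `x` and `y`, then the means differ by at most `c`. -/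
theorem integral_le_integral_add_of_ae_ae {α β : Type*} {mα : MeasurableSpace α}
    {mβ : MeasurableSpace β} {μ : Measure α} {ν : Measure β} [IsProbabilityMeasure μ]
    [IsProbabilityMeasure ν] {f : α → ℝ} {g : β → ℝ} (hf : Integrable f μ) (hg : Integrable g ν)
    {c : ℝ} {p : α → Prop} {q : β → Prop} (hp : ∀ᵐ x ∂μ, p x) (hq : ∀ᵐ y ∂ν, q y)
    (h : ∀ x y, p x → q y → f x ≤ g y + c) :
    ∫ x, f x ∂μ ≤ ∫ y, g y ∂ν + c := by
  have h1 : ∀ y, q y → ∫ x, f x ∂μ ≤ g y + c := by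
    intro y hy
    have := integral_mono_ae hf (integrable_const (g y + c)) (hp.mono fun x hx => h x y hx hy)
    simpa using this
  have h2 := integral_mono_ae (integrable_const (∫ x, f x ∂μ)) (hg.add (integrable_const c))
    (hq.mono fun y hy => h1 y hy)
  have h3 : ∫ y, (g y + c) ∂ν = ∫ y, g y ∂ν + c := by
    rw [integral_add hg (integrable_const c)]; simp
  simpa [h3] using h2

/-- A test-function form of Prokhorov closeness. -/
theorem integral_le_of_levyProkhorovDist_lt {X : Type*} [PseudoMetricSpace X] [MeasurableSpace X]
    [OpensMeasurableSpace X] {μ ν : Measure X} [IsProbabilityMeasure μ] [IsProbabilityMeasure ν]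
    {ε : ℝ} (hε : levyProkhorovDist μ ν < ε) {f g : X → ℝ} (hf : Measurable f) (hg : Measurable g)
    {R κ : ℝ} (hf0 : ∀ x, 0 ≤ f x) (hfR : ∀ x, f x ≤ R) (hg0 : ∀ x, 0 ≤ g x)
    (hgR : ∀ x, g x ≤ R) (hκ : 0 ≤ κ) {S : Set X} (hS : ∀ᵐ y ∂ν, y ∈ S)
    (h : ∀ x, ∀ y ∈ S, dist x y < ε → f x ≤ g y + κ) :
    ∫ x, f x ∂μ ≤ ∫ y, g y ∂ν + κ + R * ε := by
  have hε0 : 0 < ε := lt_of_le_of_lt ENNReal.toReal_nonneg hε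
  have hX : Nonempty X := by
    by_contra hX
    rw [not_nonempty_iff] at hX
    exact IsProbabilityMeasure.ne_zero μ (Measure.eq_zero_of_isEmpty μ)
  obtain ⟨x₀⟩ := hX
  have hR : 0 ≤ R := (hf0 x₀).trans (hfR x₀)
  have hE : levyProkhorovEDist μ ν < ENNReal.ofReal ε :=
    (ENNReal.lt_ofReal_iff_toReal_lt (levyProkhorovEDist_ne_top μ ν)).2 hε
  -- Layer cake: almost every point of the `ε`-thickening of a superlevel set of `f` lies in the
  -- superlevel set of `g + κ` at the same level, so Prokhorov closeness compares the two level by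
  -- level.
  have key : ∀ t : ℝ, μ {x | t ≤ f x} ≤ ν {y | t ≤ g y + κ} + ENNReal.ofReal ε := by
    intro t
    refine (left_measure_le_of_levyProkhorovEDist_lt hE
      (measurableSet_le measurable_const hf)).trans ?_
    gcongr 1
    rw [ENNReal.toReal_ofReal hε0.le]
    refine measure_mono_ae ?_
    filter_upwards [hS] with y hy hyt
    obtain ⟨x, hx, hxy⟩ := Metric.mem_thickening_iff.1 hyt
    exact (show t ≤ f x from hx).trans (h x y hy (by rwa [dist_comm]))
  have hintf : Integrable f μ := integrable_of_measurable_of_bounded (B := R) hf fun x => by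
    rw [abs_of_nonneg (hf0 x)]; exact hfR x
  have hintg : Integrable g ν := integrable_of_measurable_of_bounded (B := R) hg fun x => by
    rw [abs_of_nonneg (hg0 x)]; exact hgR x
  have hlin : ∫⁻ x, ENNReal.ofReal (f x) ∂μ ≤
      ∫⁻ y, ENNReal.ofReal (g y + κ) ∂ν + ENNReal.ofReal (R * ε) := by
    rw [lintegral_eq_lintegral_meas_le μ (ae_of_all _ hf0) hf.aemeasurable,
      lintegral_eq_lintegral_meas_le ν (ae_of_all _ fun y => add_nonneg (hg0 y) hκ)
        (hg.add_const κ).aemeasurable]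
    -- Above `R` the superlevel set of `f` is empty, so the error `ε` is paid only on `(0, R]` and
    -- integrates to `R * ε`.
    have hb : ∀ t : ℝ, μ {x | t ≤ f x} ≤
        ν {y | t ≤ g y + κ} + (Set.Iic R).indicator (fun _ => ENNReal.ofReal ε) t := by
      intro t
      by_cases ht : t ≤ R
      · simpa [ht] using key t
      · have : {x | t ≤ f x} = ∅ := by
          ext x
          simp only [Set.mem_ofPred_eq, Set.mem_empty_iff_false, iff_false, not_le]
          exact (hfR x).trans_lt (not_le.1 ht)
        simp [this]
    refine (lintegral_mono hb).trans ?_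
    rw [lintegral_add_right _ (measurable_const.indicator measurableSet_Iic)]
    gcongr
    rw [lintegral_indicator measurableSet_Iic, setLIntegral_const,
      Measure.restrict_apply measurableSet_Iic, Set.inter_comm, Set.Ioi_inter_Iic,
      Real.volume_Ioc, sub_zero, ← ENNReal.ofReal_mul hε0.le, mul_comm]
  have hg' : ∫⁻ y, ENNReal.ofReal (g y + κ) ∂ν = ENNReal.ofReal (∫ y, g y ∂ν + κ) := by
    have hi : Integrable (fun y => g y + κ) ν := hintg.add (integrable_const κ)
    rw [← ofReal_integral_eq_lintegral_ofReal hi (ae_of_all _ fun y => add_nonneg (hg0 y) hκ),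
      integral_add hintg (integrable_const κ)]
    simp
  rw [hg', ← ofReal_integral_eq_lintegral_ofReal hintf (ae_of_all _ hf0),
    ← ENNReal.ofReal_add (add_nonneg (integral_nonneg hg0) hκ) (mul_nonneg hR hε0.le),
    ENNReal.ofReal_le_ofReal_iff
      (add_nonneg (add_nonneg (integral_nonneg hg0) hκ) (mul_nonneg hR hε0.le))] at hlin
  exact hlin

section Pi

theorem isProbabilityMeasure_update {ι X : Type*} [DecidableEq ι] [MeasurableSpace X]
    (F : ι → Measure X) [∀ j, IsProbabilityMeasure (F j)] (i : ι) (ν : Measure X)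
    [IsProbabilityMeasure ν] (j : ι) :
    IsProbabilityMeasure (Function.update F i ν j) := by
  by_cases h : j = i
  · subst h; simpa
  · simpa [h] using (inferInstance : IsProbabilityMeasure (F j))

variable {ι : Type*} [Fintype ι] {X : Type*} [MeasurableSpace X]

theorem lintegral_pi_prod (F : ι → Measure X) [∀ j, IsProbabilityMeasure (F j)]
    {g : ι → X → ℝ≥0∞} (hg : ∀ j, Measurable (g j)) :
    ∫⁻ z, ∏ j, g j (z j) ∂(Measure.pi F) = ∏ j, ∫⁻ a, g j a ∂(F j) := by
  have hind : iIndepFun (fun j (z : ι → X) => g j (z j)) (Measure.pi F) :=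
    iIndepFun_pi (X := fun j => g j) fun j => (hg j).aemeasurable
  rw [lintegral_prod_eq_prod_lintegral_of_indepFun Finset.univ _ hind
    fun j => (hg j).comp (measurable_pi_apply j)]
  refine Finset.prod_congr rfl fun j _ => ?_
  have h := measurePreserving_eval F j
  rw [← h.lintegral_comp (hg j)]

theorem measurable_measure_pi {α : Type*} [MeasurableSpace α] {κ : ι → α → Measure X}
    [∀ j a, IsProbabilityMeasure (κ j a)] (h : ∀ j, Measurable (κ j)) :
    Measurable fun a => Measure.pi fun j => κ j a := by
  refine Measurable.measure_of_isPiSystem_of_isProbabilityMeasure generateFrom_pi.symm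
    isPiSystem_pi ?_
  rintro s ⟨t, ht, rfl⟩
  simp only [Measure.pi_pi]
  exact Finset.measurable_prod _ fun j _ =>
    (Measure.measurable_coe (ht j (Set.mem_univ j))).comp (h j)

variable [DecidableEq ι]

theorem pi_update_eq_map (F : ι → Measure X) [∀ j, IsProbabilityMeasure (F j)] (i : ι)
    (ν : Measure X) [IsProbabilityMeasure ν] :
    Measure.pi (Function.update F i ν) =
      (ν.prod (Measure.pi F)).map fun q => Function.update q.2 i q.1 := by
  have hp : ∀ j, IsProbabilityMeasure (Function.update F i ν j) := by
    intro j
    by_cases h : j = i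
    · subst h; simpa
    · simpa [h] using (inferInstance : IsProbabilityMeasure (F j))
  have hm : Measurable fun q : X × (ι → X) => Function.update q.2 i q.1 := by fun_prop
  refine Measure.pi_eq fun s hs => ?_
  rw [Measure.map_apply hm (MeasurableSet.univ_pi hs)]
  have : (fun q : X × (ι → X) => Function.update q.2 i q.1) ⁻¹' (Set.univ.pi s) =
      s i ×ˢ Set.univ.pi (Function.update s i Set.univ) := by
    ext ⟨a, z⟩
    simp only [Set.mem_preimage, Set.mem_pi, Set.mem_univ, true_imp_iff, Set.mem_prod]
    constructor
    · intro h
      refine ⟨by simpa using h i, fun j => ?_⟩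
      by_cases hj : j = i
      · subst hj; simp
      · simpa [hj] using h j
    · rintro ⟨h1, h2⟩ j
      by_cases hj : j = i
      · subst hj; simpa using h1
      · simpa [hj] using h2 j
  rw [this, Measure.prod_prod, Measure.pi_pi,
    ← Finset.mul_prod_erase Finset.univ (fun j => Function.update F i ν j (s j))
      (Finset.mem_univ i),
    ← Finset.mul_prod_erase Finset.univ (fun j => F j (Function.update s i Set.univ j))
      (Finset.mem_univ i)]
  simp only [Function.update_self, measure_univ, one_mul]
  congr 1
  refine Finset.prod_congr rfl fun j hj => ?_
  have hj' : j ≠ i := (Finset.mem_erase.1 hj).1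
  simp [hj']

theorem integral_pi_update (F : ι → Measure X) [∀ j, IsProbabilityMeasure (F j)] (i : ι)
    (ν : Measure X) [IsProbabilityMeasure ν] {f : (ι → X) → ℝ} (hf : Measurable f)
    (hfi : Integrable f (Measure.pi (Function.update F i ν))) :
    ∫ z, f z ∂(Measure.pi (Function.update F i ν)) =
      ∫ a, ∫ s, f (Function.update s i a) ∂(Measure.pi F) ∂ν := by
  have hm : Measurable fun q : X × (ι → X) => Function.update q.2 i q.1 := by fun_prop
  rw [pi_update_eq_map] at hfi ⊢
  rw [integral_map hm.aemeasurable hf.aestronglyMeasurable]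
  exact integral_prod _ ((integrable_map_measure hf.aestronglyMeasurable hm.aemeasurable).1 hfi)

/-- A fixed report is a Dirac factor. Interim quantities, where one coordinate is overwritten, thus
become integrals over product measures. -/
theorem integral_pi_update_dirac (F : ι → Measure X) [∀ j, IsProbabilityMeasure (F j)] (i : ι)
    (r : X) {f : (ι → X) → ℝ} (hf : Measurable f) :
    ∫ z, f z ∂(Measure.pi (Function.update F i (Measure.dirac r))) =
      ∫ s, f (Function.update s i r) ∂(Measure.pi F) := by
  have hm : Measurable fun q : X × (ι → X) => Function.update q.2 i q.1 := by fun_prop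
  have hm' : Measurable fun s : ι → X => (r, s) := by fun_prop
  rw [pi_update_eq_map, Measure.dirac_prod, Measure.map_map hm hm',
    integral_map (hm.comp hm').aemeasurable hf.aestronglyMeasurable]
  rfl

/-- Replacing the factors of a product measure one at a time. -/
theorem abs_integral_pi_sub_le (μ ν : ι → Measure X) [∀ j, IsProbabilityMeasure (μ j)]
    [∀ j, IsProbabilityMeasure (ν j)] {f : (ι → X) → ℝ} (hf : Measurable f) {B : ℝ}
    (hB : ∀ z, |f z| ≤ B) {e : ℝ}
    (he : ∀ j z, |∫ a, f (Function.update z j a) ∂(μ j) -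
      ∫ a, f (Function.update z j a) ∂(ν j)| ≤ e) :
    |∫ z, f z ∂(Measure.pi μ) - ∫ z, f z ∂(Measure.pi ν)| ≤ Fintype.card ι * e := by
  -- Hybrid argument: `T` is the set of factors already replaced, and each enlargement of `T` by one
  -- index costs `e`.
  suffices h : ∀ T : Finset ι,
      |∫ z, f z ∂(Measure.pi μ) - ∫ z, f z ∂(Measure.pi (T.piecewise ν μ))| ≤ T.card * e by
    simpa using h Finset.univ
  intro T
  induction T using Finset.induction_on with
  | empty => simp
  | insert i T hi ih =>
    set G := T.piecewise ν μ with hG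
    have hGp : ∀ j, IsProbabilityMeasure (G j) := by
      intro j
      by_cases h : j ∈ T <;> simp [hG, h] <;> infer_instance
    have h1 : (insert i T).piecewise ν μ = Function.update G i (ν i) := by
      rw [Finset.piecewise_insert]
    have h2 : G = Function.update G i (μ i) := by
      rw [eq_comm, Function.update_eq_self_iff]; simp [hG, hi]
    have hfi : ∀ (m : Measure (ι → X)) [IsFiniteMeasure m], Integrable f m := fun m _ =>
      integrable_of_measurable_of_bounded hf hB
    have hup : ∀ (m : Measure X) [IsProbabilityMeasure m],
        ∫ z, f z ∂(Measure.pi (Function.update G i m)) =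
          ∫ s, ∫ a, f (Function.update s i a) ∂m ∂(Measure.pi G) := by
      intro m _
      have := isProbabilityMeasure_update G i m
      rw [integral_pi_update G i m hf (hfi _)]
      refine integral_integral_swap ?_
      exact integrable_of_measurable_of_bounded (B := B)
        (by unfold Function.uncurry; exact hf.comp (by fun_prop)) fun q => hB _
    have hinner : ∀ (m : Measure X) [IsProbabilityMeasure m],
        Integrable (fun s => ∫ a, f (Function.update s i a) ∂m) (Measure.pi G) := by
      intro m _
      refine Integrable.of_bound (C := B) ?_ (ae_of_all _ fun s =>
        abs_integral_le_of_bounded (ae_of_all _ fun a => hB _))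
      have hmeas : Measurable (Function.uncurry fun (s : ι → X) (a : X) =>
          f (Function.update s i a)) := hf.comp (by fun_prop)
      exact (hmeas.stronglyMeasurable.integral_prod_right (ν := m)).aestronglyMeasurable
    have hstep : |∫ z, f z ∂(Measure.pi G) -
        ∫ z, f z ∂(Measure.pi (Function.update G i (ν i)))| ≤ e := by
      have : ∫ z, f z ∂(Measure.pi G) = ∫ z, f z ∂(Measure.pi (Function.update G i (μ i))) := by
        rw [← h2]
      rw [this, hup, hup, ← integral_sub (hinner _) (hinner _)]
      exact abs_integral_le_of_bounded (ae_of_all _ fun s => he i s)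
    rw [h1, Finset.card_insert_of_notMem hi]
    push_cast
    calc _ = |(∫ z, f z ∂(Measure.pi μ) - ∫ z, f z ∂(Measure.pi G)) + (∫ z, f z ∂(Measure.pi G) -
        ∫ z, f z ∂(Measure.pi (Function.update G i (ν i))))| := by congr 1; ring
      _ ≤ _ := (abs_add_le _ _).trans (by linarith)

end Pi

end MeasureLemmas

/-! ### Norm comparisons and the Lipschitz constant of latent valuations. -/

section Geometry

variable {k : ℕ} {p : ℝ≥0∞}

theorem abs_sub_apply_le_dist [Fact (1 ≤ p)] (x y : Latent p k) (j : Fin k) :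
    |x j - y j| ≤ dist x y := by
  rw [dist_eq_norm]
  exact PiLp.norm_apply_le (x - y) j

/-- The power mean inequality. This is the source of the factor `k^(1-1/p)`, since a random grid
separates points according to their `ℓ_1` distance. -/
theorem sum_abs_sub_le_rpow_mul_dist [Fact (1 ≤ p)] (x y : Latent p k) :
    ∑ j, |x j - y j| ≤ (k : ℝ) ^ (1 - 1 / p.toReal) * dist x y := by
  -- For `p = ∞` one has `p.toReal = 0` and `1 / 0 = 0`, so the exponent is `1`, as it should be.
  rcases eq_or_ne p ∞ with hp | hp
  · subst hp
    have : ∑ j, |x j - y j| ≤ ∑ _j : Fin k, dist x y :=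
      Finset.sum_le_sum fun j _ => abs_sub_apply_le_dist x y j
    simpa using this
  · have h1 : 1 ≤ p.toReal := by
      rw [← ENNReal.toReal_one]
      exact ENNReal.toReal_mono hp Fact.out
    have h0 : 0 < p.toReal := by linarith
    have hs := Real.rpow_sum_le_const_mul_sum_rpow Finset.univ (fun j => x j - y j) h1
    have hnn : 0 ≤ ∑ j, |x j - y j| := Finset.sum_nonneg fun j _ => abs_nonneg _
    have hnn' : 0 ≤ ∑ j, |x j - y j| ^ p.toReal :=
      Finset.sum_nonneg fun j _ => Real.rpow_nonneg (abs_nonneg _) _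
    rw [PiLp.dist_eq_sum h0]
    simp only [Real.dist_eq]
    have h2 := Real.rpow_le_rpow (Real.rpow_nonneg hnn _) hs (by positivity : 0 ≤ 1 / p.toReal)
    rw [← Real.rpow_mul hnn, mul_one_div_cancel h0.ne', Real.rpow_one,
      Real.mul_rpow (by positivity) hnn', ← Real.rpow_mul (by positivity)] at h2
    simp only [Finset.card_univ, Fintype.card_fin] at h2
    have h3 : (p.toReal - 1) * (1 / p.toReal) = 1 - 1 / p.toReal := by field_simp
    rwa [h3] at h2

theorem abs_le_maxEntry {d : ℕ} (A : Matrix (Fin d) (Fin k) ℝ) (a : Fin d) (b : Fin k) :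
    |A a b| ≤ maxEntry A :=
  le_ciSup (f := fun e : Fin d × Fin k => |A e.1 e.2|) (Set.finite_range _).bddAbove (a, b)

theorem maxEntry_nonneg {d : ℕ} (A : Matrix (Fin d) (Fin k) ℝ) : 0 ≤ maxEntry A :=
  Real.iSup_nonneg fun _ => abs_nonneg _

theorem norm_mulVec_sub_le {d : ℕ} (A : Matrix (Fin d) (Fin k) ℝ) {x y : Fin k → ℝ} {D : ℝ}
    (h : ∀ j, |x j - y j| ≤ D) : ‖A.mulVec x - A.mulVec y‖ ≤ maxEntry A * (k * D) := by
  -- Without coordinates the hypothesis does not force `0 ≤ D`.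
  rcases Nat.eq_zero_or_pos k with hk | hk
  · subst hk
    have : x = y := Subsingleton.elim _ _
    simp [this]
  have hD : 0 ≤ D := (abs_nonneg _).trans (h ⟨0, hk⟩)
  have h0 := maxEntry_nonneg A
  rw [pi_norm_le_iff_of_nonneg (by positivity)]
  intro a
  rw [Pi.sub_apply, Matrix.mulVec, Matrix.mulVec, ← dotProduct_sub, Real.norm_eq_abs]
  calc |∑ j, A a j * (x - y) j| ≤ ∑ j, |A a j * (x - y) j| := Finset.abs_sum_le_sum_abs _ _
    _ ≤ ∑ _j : Fin k, maxEntry A * D := by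
      refine Finset.sum_le_sum fun j _ => ?_
      rw [abs_mul]
      exact mul_le_mul (abs_le_maxEntry A a j) (h j) (abs_nonneg _) h0
    _ = maxEntry A * (k * D) := by simp; ring

theorem abs_latentValuation_sub_le {d m : ℕ} {L : ℝ} (hL : 0 ≤ L) (A : Matrix (Fin d) (Fin k) ℝ)
    {v : (Fin d → ℝ) → Set (Fin m) → ℝ≥0} (hv : IsLipschitzValuation L v) {x y : Latent p k}
    {D : ℝ} (h : ∀ j, |x j - y j| ≤ D) (S : Set (Fin m)) :
    |(latentValuation p A v x S : ℝ) - latentValuation p A v y S| ≤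
      k * L * maxEntry A * D := by
  refine (hv _ _ S).trans ?_
  calc _ ≤ L * (maxEntry A * (k * D)) := mul_le_mul_of_nonneg_left (norm_mulVec_sub_le A h) hL
    _ = _ := by ring

end Geometry

/-! ### The randomly shifted grid. -/

section Grid

variable {k : ℕ} {p : ℝ≥0∞}

/-- The index of the cell of `x` in the grid of side `δ` shifted by `u`. -/
def cellIndex (δ : ℝ) (u : Fin k → ℝ) (x : Latent p k) : Fin k → ℤ := fun j => ⌊x j / δ + u j⌋

/-- The lower corner of the cell of `x` in the grid of side `δ` shifted by `u`. -/
def cellCorner (δ : ℝ) (u : Fin k → ℝ) (x : Latent p k) : Latent p k :=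
  WithLp.toLp p fun j => δ * (cellIndex δ u x j - u j)

/-- Half-open boxes are exactly the fibres of the floor map, so a query to the sampler on such a box
conditions on a cell of a partition. -/
theorem box_cellCorner {δ : ℝ} (hδ : 0 < δ) (u : Fin k → ℝ) (x : Latent p k) :
    box (cellCorner δ u x) (fun _ => δ) = cellIndex δ u ⁻¹' {cellIndex δ u x} := by
  ext y
  simp only [box, cellCorner, Set.mem_ofPred_eq, Set.mem_preimage, Set.mem_singleton_iff,
    funext_iff]
  refine forall_congr' fun j => ?_
  rw [show cellIndex δ u y j = ⌊y j / δ + u j⌋ from rfl, Int.floor_eq_iff]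
  have h : y j = δ * (y j / δ) := by field_simp
  constructor
  · rintro ⟨h1, h2⟩
    rw [h] at h1 h2
    have h1' := le_of_mul_le_mul_left h1 hδ
    have h2' : y j / δ < cellIndex δ u x j - u j + 1 := by
      refine lt_of_mul_lt_mul_left (a := δ) (h2.trans_eq ?_) hδ.le
      ring
    constructor <;> linarith
  · rintro ⟨h1, h2⟩
    constructor
    · rw [h]; exact mul_le_mul_of_nonneg_left (by linarith) hδ.le
    · calc y j = δ * (y j / δ) := h
        _ < δ * (cellIndex δ u x j - u j + 1) := mul_lt_mul_of_pos_left (by linarith) hδ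
        _ = _ := by ring

theorem abs_sub_apply_lt_of_cellIndex_eq {δ : ℝ} (hδ : 0 < δ) {u : Fin k → ℝ} {x y : Latent p k}
    (h : cellIndex δ u x = cellIndex δ u y) (j : Fin k) : |x j - y j| < δ := by
  have h1 := Int.abs_sub_lt_one_of_floor_eq_floor (congrFun h j)
  rw [add_sub_add_right_eq_sub, ← sub_div, abs_div, abs_of_pos hδ, div_lt_one hδ] at h1
  exact h1

@[fun_prop]
theorem measurable_cellIndex (δ : ℝ) :
    Measurable fun q : (Fin k → ℝ) × Latent p k => cellIndex δ q.1 q.2 := by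
  unfold cellIndex
  fun_prop

@[fun_prop]
theorem measurable_cellCorner (δ : ℝ) :
    Measurable fun q : (Fin k → ℝ) × Latent p k => cellCorner δ q.1 q.2 := by
  unfold cellCorner cellIndex
  fun_prop

/-- The uniform distribution on the unit cube. -/
abbrev unitCube (k : ℕ) : Measure (Fin k → ℝ) := volume.restrict (Set.Icc 0 1)

theorem unitCube_eq_pi (k : ℕ) :
    unitCube k = Measure.pi fun _ => (volume : Measure ℝ).restrict (Set.Icc 0 1) := by
  rw [← Measure.restrict_pi_pi, unitCube, volume_pi, Set.pi_univ_Icc]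
  rfl

instance isProbabilityMeasure_unitInterval :
    IsProbabilityMeasure ((volume : Measure ℝ).restrict (Set.Icc 0 1)) :=
  ⟨by simp⟩

instance isProbabilityMeasure_unitCube (k : ℕ) : IsProbabilityMeasure (unitCube k) := by
  rw [unitCube_eq_pi]; infer_instance

theorem measurePreserving_eval_unitCube (j : Fin k) :
    MeasurePreserving (Function.eval j) (unitCube k)
      ((volume : Measure ℝ).restrict (Set.Icc 0 1)) := by
  rw [unitCube_eq_pi]
  exact measurePreserving_eval _ j

theorem measurableSet_floor_add_ne (a b : ℝ) : MeasurableSet {t : ℝ | ⌊a + t⌋ ≠ ⌊b + t⌋} :=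
  (measurableSet_eq_fun (by fun_prop) (by fun_prop)).compl

/-- A random shift of the integer grid separates two points with probability at most twice
their distance. -/
theorem volume_floor_add_ne_le (a b : ℝ) :
    ((volume : Measure ℝ).restrict (Set.Icc 0 1)).real {t : ℝ | ⌊a + t⌋ ≠ ⌊b + t⌋} ≤
      2 * |a - b| := by
  wlog hab : a ≤ b generalizing a b
  · have := this b a (le_of_not_ge hab)
    rw [abs_sub_comm]
    simpa only [ne_comm] using this
  rw [abs_sub_comm, abs_of_nonneg (sub_nonneg.2 hab)]
  -- For larger gaps the bound is at least `1`. For smaller ones, an integer in `(a + t, b + t]`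
  -- with `t ∈ [0,1]` can only be `⌊a⌋ + 1` or `⌊a⌋ + 2`. Each confines `t` to an interval of length
  -- `b - a`, hence the factor `2`.
  by_cases hlt : b - a < 1 / 2
  swap
  · have : ((volume : Measure ℝ).restrict (Set.Icc 0 1)).real {t : ℝ | ⌊a + t⌋ ≠ ⌊b + t⌋} ≤ 1 :=
      measureReal_le_one
    linarith
  have hsub : {t : ℝ | ⌊a + t⌋ ≠ ⌊b + t⌋} ∩ Set.Icc 0 1 ⊆
      Set.Ico (⌊a⌋ + 1 - b) (⌊a⌋ + 1 - a) ∪ Set.Ico (⌊a⌋ + 2 - b) (⌊a⌋ + 2 - a) := by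
    rintro t ⟨ht, ht0, ht1⟩
    have hlt' : ⌊a + t⌋ < ⌊b + t⌋ :=
      lt_of_le_of_ne (Int.floor_le_floor (by linarith)) ht
    have h1 : a + t < ⌊b + t⌋ := Int.floor_lt.1 hlt'
    have h2 := Int.floor_le (b + t)
    have h3 : ⌊a⌋ < ⌊b + t⌋ := by
      have := Int.floor_le a
      have : (⌊a⌋ : ℝ) < ⌊b + t⌋ := by linarith
      exact_mod_cast this
    have h4 : ⌊b + t⌋ < ⌊a⌋ + 3 := by
      have := Int.lt_floor_add_one a
      have : (⌊b + t⌋ : ℝ) < ⌊a⌋ + 3 := by linarith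
      exact_mod_cast this
    rcases (show ⌊b + t⌋ = ⌊a⌋ + 1 ∨ ⌊b + t⌋ = ⌊a⌋ + 2 by omega) with h | h
    · left
      rw [h] at h1 h2
      push_cast at h1 h2
      constructor <;> linarith
    · right
      rw [h] at h1 h2
      push_cast at h1 h2
      constructor <;> linarith
  rw [measureReal_restrict_apply (measurableSet_floor_add_ne a b)]
  refine (measureReal_mono hsub ?_).trans ((measureReal_union_le _ _).trans ?_)
  · exact ((measure_union_le _ _).trans_lt (by simp)).ne
  · rw [Real.volume_real_Ico_of_le (by linarith), Real.volume_real_Ico_of_le (by linarith)]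
    linarith

/-- Different cells means that some coordinate is separated; a union bound over the coordinates
gives the `ℓ_1` distance. -/
theorem unitCube_cellIndex_ne_le {δ : ℝ} (hδ : 0 < δ) (x y : Latent p k) :
    (unitCube k).real {u | cellIndex δ u x ≠ cellIndex δ u y} ≤
      2 * (∑ j, |x j - y j|) / δ := by
  have hsub : {u : Fin k → ℝ | cellIndex δ u x ≠ cellIndex δ u y} ⊆
      ⋃ j, Function.eval j ⁻¹' {t : ℝ | ⌊x j / δ + t⌋ ≠ ⌊y j / δ + t⌋} := by
    intro u hu
    obtain ⟨j, hj⟩ := Function.ne_iff.1 hu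
    exact Set.mem_iUnion.2 ⟨j, hj⟩
  refine (measureReal_mono hsub).trans ((measureReal_iUnion_fintype_le _).trans ?_)
  rw [mul_div_assoc, Finset.sum_div, Finset.mul_sum]
  refine Finset.sum_le_sum fun j _ => ?_
  rw [(measurePreserving_eval_unitCube j).measureReal_preimage
    (measurableSet_floor_add_ne _ _).nullMeasurableSet]
  refine (volume_floor_add_ne_le _ _).trans_eq ?_
  rw [← sub_div, abs_div, abs_of_pos hδ]

/-- Only countably many shifts of a coordinate put `x` on a grid hyperplane. For all others the cell
is a neighbourhood of `x`, and a neighbourhood of a support point has positive mass. Hence the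
sampler's unspecified answers almost surely play no role. -/
theorem ae_measure_cell_ne_zero [Fact (1 ≤ p)] (δ : ℝ) {F : Measure (Latent p k)}
    {x : Latent p k} (hx : x ∈ F.support) :
    ∀ᵐ u ∂(unitCube k), F (cellIndex δ u ⁻¹' {cellIndex δ u x}) ≠ 0 := by
  have hj : ∀ j : Fin k, ∀ᵐ u ∂(unitCube k), (⌊x j / δ + u j⌋ : ℝ) ≠ x j / δ + u j := by
    intro j
    have h0 : ∀ᵐ t ∂((volume : Measure ℝ).restrict (Set.Icc 0 1)),
        (⌊x j / δ + t⌋ : ℝ) ≠ x j / δ + t := by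
      refine ae_restrict_of_ae ?_
      have hc : (Set.range fun m : ℤ => (m : ℝ) - x j / δ).Countable := Set.countable_range _
      filter_upwards [hc.ae_notMem volume] with t ht heq
      exact ht ⟨⌊x j / δ + t⌋, by simp only [heq]; ring⟩
    exact (measurePreserving_eval_unitCube j).quasiMeasurePreserving.ae h0
  filter_upwards [ae_all_iff.2 hj] with u hu
  refine ((Measure.mem_support_iff_forall x).1 hx _ ?_).ne'
  have hev : ∀ j : Fin k, ∀ᶠ y in nhds x, ⌊y j / δ + u j⌋ = ⌊x j / δ + u j⌋ := by
    intro j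
    have hcont : Filter.Tendsto (fun y : Latent p k => y j / δ + u j) (nhds x)
        (nhds (x j / δ + u j)) := by
      have : Continuous fun y : Latent p k => y j / δ + u j := by fun_prop
      exact this.tendsto x
    have hlt : (⌊x j / δ + u j⌋ : ℝ) < x j / δ + u j := lt_of_le_of_ne (Int.floor_le _) (hu j)
    filter_upwards [hcont.eventually (lt_mem_nhds hlt),
      hcont.eventually (gt_mem_nhds (Int.lt_floor_add_one _))] with y h1 h2
    exact Int.floor_eq_iff.2 ⟨h1.le, h2⟩
  filter_upwards [Filter.eventually_all.2 hev] with y hy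
  exact funext hy

end Grid

/-! ### Resampling inside the cells of a partition. -/

section Resampling

/-- Resampling a point from its own cell of a countable measurable partition does not change
the distribution. -/
theorem bind_cond_preimage_eq {X ι : Type*} [MeasurableSpace X] [MeasurableSpace ι] [Countable ι]
    [MeasurableSingletonClass ι] {F : Measure X} [IsProbabilityMeasure F] {c : X → ι}
    (hc : Measurable c) {κ : X → Measure X} (hκ : Measurable κ)
    (h : ∀ x, F (c ⁻¹' {c x}) ≠ 0 → κ x = cond F (c ⁻¹' {c x})) : F.bind κ = F := by
  have hms : ∀ m, MeasurableSet (c ⁻¹' {m}) := fun m => hc (measurableSet_singleton m)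
  ext B hB
  rw [Measure.bind_apply hB hκ.aemeasurable]
  -- The null cells are countably many, so together they form a null set, on which `κ` may be
  -- arbitrary.
  have hae : ∀ᵐ x ∂F, κ x B = cond F (c ⁻¹' {c x}) B := by
    have : ∀ᵐ x ∂F, ∀ m, F (c ⁻¹' {m}) = 0 → c x ≠ m := by
      refine ae_all_iff.2 fun m => ?_
      by_cases hm : F (c ⁻¹' {m}) = 0
      · filter_upwards [measure_eq_zero_iff_ae_notMem.1 hm] with x hx _ using hx
      · exact ae_of_all _ fun x h => absurd h hm
    filter_upwards [this] with x hx
    rw [h x fun h0 => hx (c x) h0 rfl]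
  rw [lintegral_congr_ae hae,
    ← lintegral_map (f := fun m => cond F (c ⁻¹' {m}) B) (measurable_of_countable _) hc,
    lintegral_countable']
  -- The probability of landing in a cell cancels the normalization of the conditional law.
  have hterm : ∀ m, cond F (c ⁻¹' {m}) B * F.map c {m} = F (c ⁻¹' {m} ∩ B) := by
    intro m
    rw [Measure.map_apply hc (measurableSet_singleton m), cond_apply (hms m)]
    by_cases hm : F (c ⁻¹' {m}) = 0
    · rw [hm, mul_zero]
      exact (measure_mono_null Set.inter_subset_left hm).symm
    · rw [mul_comm, ← mul_assoc, ENNReal.mul_inv_cancel hm (measure_ne_top _ _), one_mul]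
  simp_rw [hterm]
  rw [← measure_iUnion _ fun m => (hms m).inter hB, ← Set.iUnion_inter]
  · congr 1
    ext x
    simp
  · intro a b hab
    refine Set.disjoint_left.2 fun x hx hx' => hab ?_
    exact (show c x = a from hx.1).symm.trans hx'.1

end Resampling

/-! ### Averaging a kernel over the random shift. -/

section Averaging

variable {α β : Type*} [MeasurableSpace α] [MeasurableSpace β] {k : ℕ}

/-- The kernel `κ` averaged over a uniform second argument. -/
def averaged (κ : Kernel (α × (Fin k → ℝ)) β) : Kernel α β :=
  κ ∘ₖ (Kernel.id ×ₖ Kernel.const α (unitCube k))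

instance (κ : Kernel (α × (Fin k → ℝ)) β) [IsMarkovKernel κ] : IsMarkovKernel (averaged κ) := by
  unfold averaged; infer_instance

theorem averaged_apply (κ : Kernel (α × (Fin k → ℝ)) β) (a : α) :
    averaged κ a = (unitCube k).bind fun u => κ (a, u) := by
  have hm : Measurable fun u : Fin k → ℝ => (a, u) := by fun_prop
  ext s hs
  rw [averaged, Kernel.comp_apply, Kernel.prod_apply, Kernel.id_apply, Kernel.const_apply,
    Measure.dirac_prod, Measure.bind_apply hs κ.aemeasurable,
    lintegral_map (κ.measurable_coe hs) hm,
    Measure.bind_apply (f := fun u => κ (a, u)) hs (κ.measurable.comp hm).aemeasurable]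

theorem averaged_apply' (κ : Kernel (α × (Fin k → ℝ)) β) (a : α) {s : Set β}
    (hs : MeasurableSet s) : averaged κ a s = ∫⁻ u, κ (a, u) s ∂(unitCube k) := by
  have hm : Measurable fun u : Fin k → ℝ => (a, u) := by fun_prop
  rw [averaged_apply, Measure.bind_apply (f := fun u => κ (a, u)) hs
    (κ.measurable.comp hm).aemeasurable]

theorem integral_averaged (κ : Kernel (α × (Fin k → ℝ)) β) (a : α) {f : β → ℝ}
    (hf : Integrable f (averaged κ a)) :
    ∫ y, f y ∂(averaged κ a) = ∫ u, ∫ y, f y ∂(κ (a, u)) ∂(unitCube k) := by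
  have hm : Measurable fun u : Fin k → ℝ => (a, u) := by fun_prop
  have h : averaged κ a = (unitCube k).bind (κ.comap _ hm) := averaged_apply κ a
  rw [h] at hf ⊢
  exact integral_bind_kernel hf

theorem ae_averaged (κ : Kernel (α × (Fin k → ℝ)) β) (a : α) {q : β → Prop}
    (hq : MeasurableSet {y | q y}) (h : ∀ᵐ u ∂(unitCube k), ∀ᵐ y ∂(κ (a, u)), q y) :
    ∀ᵐ y ∂(averaged κ a), q y := by
  have hm : Measurable fun u : Fin k → ℝ => (a, u) := by fun_prop
  have h' : averaged κ a = (unitCube k).bind (κ.comap _ hm) := averaged_apply κ a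
  rw [h']
  exact Measure.ae_comp_of_ae_ae hq h

end Averaging

/-! ### The program and the kernel it implements. -/

section Construction

variable {n m k : ℕ} {p : ℝ≥0∞}

/-- The final outcome: bidders whose report is farther than `τ` from the support point are
dropped, the others get a discount of `c`. -/
def robustOutput (τ : ℝ) (c : ℝ≥0) (b s : Fin n → Latent p k) (o : Outcome n m) : Outcome n m :=
  (fun i => if dist (b i) (s i) ≤ τ then o.1 i else ∅,
    fun i => if dist (b i) (s i) ≤ τ then o.2 i - c else 0)

theorem measurable_robustOutput_right (τ : ℝ) (c : ℝ≥0) (b s : Fin n → Latent p k) :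
    Measurable (robustOutput (m := m) τ c b s) := by
  refine Measurable.prodMk (measurable_pi_lambda _ fun i => ?_)
    (measurable_pi_lambda _ fun i => ?_)
  · by_cases h : dist (b i) (s i) ≤ τ
    · simp only [h, if_true]; fun_prop
    · simp only [h, if_false]; fun_prop
  · by_cases h : dist (b i) (s i) ≤ τ
    · simp only [h, if_true]; fun_prop
    · simp only [h, if_false]; fun_prop

/-- Round the reports to the support, resample them from the cells of a randomly shifted grid of
side `δ`, and query the mechanism at the resampled profile. -/
def robustProgram (m : ℕ) (δ τ : ℝ) (c : ℝ≥0) (b : Fin n → Latent p k) : OracleProgram n m p k :=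
  .nearest b fun s => .uniform k fun u =>
    .draw (fun i => cellCorner δ u (s i)) (fun _ _ => δ) fun y =>
      .query y fun o => .output (robustOutput τ c b s o)

variable [Fact (1 ≤ p)] {G : Fin n → Measure (Latent p k)}

instance (O : LatentOracle G) (i : Fin n) : IsMarkovKernel (O.draw i) := O.draw_markov i

/-- Resampling of a single report, for a given shift of the grid. -/
def cellSampler (O : LatentOracle G) (δ : ℝ) (i : Fin n) :
    Kernel (Latent p k × (Fin k → ℝ)) (Latent p k) :=
  (O.draw i).comap (fun q => (cellCorner δ q.2 (O.nearest i q.1), fun _ => δ))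
    (((measurable_cellCorner δ).comp (measurable_snd.prodMk
      ((O.nearest_measurable i).comp measurable_fst))).prodMk measurable_const)

instance (O : LatentOracle G) (δ : ℝ) (i : Fin n) : IsMarkovKernel (cellSampler O δ i) := by
  unfold cellSampler; infer_instance

theorem cellSampler_apply (O : LatentOracle G) (δ : ℝ) (i : Fin n) (a : Latent p k)
    (u : Fin k → ℝ) :
    cellSampler O δ i (a, u) = O.draw i (cellCorner δ u (O.nearest i a), fun _ => δ) := rfl

/-- The queried box is determined by the cell index, so reports rounded into the same cell become
indistinguishable. -/
theorem cellSampler_congr (O : LatentOracle G) (δ : ℝ) (i : Fin n) {a b : Latent p k}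
    {u : Fin k → ℝ}
    (h : cellIndex δ u (O.nearest i a) = cellIndex δ u (O.nearest i b)) :
    cellSampler O δ i (a, u) = cellSampler O δ i (b, u) := by
  rw [cellSampler_apply, cellSampler_apply, cellCorner, cellCorner, h]

/-- Resampling of all reports, for a given shift of the grid. -/
def profileSampler (O : LatentOracle G) (δ : ℝ) :
    Kernel ((Fin n → Latent p k) × (Fin k → ℝ)) (Fin n → Latent p k) where
  toFun q := Measure.pi fun i => cellSampler O δ i (q.1 i, q.2)
  measurable' := by
    have hm : ∀ i : Fin n, Measurable fun q : (Fin n → Latent p k) × (Fin k → ℝ) =>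
        (q.1 i, q.2) := fun i => by fun_prop
    exact measurable_measure_pi (κ := fun i q => ((cellSampler O δ i).comap _ (hm i)) q) fun i =>
      ((cellSampler O δ i).comap _ (hm i)).measurable

theorem profileSampler_apply (O : LatentOracle G) (δ : ℝ) (z : Fin n → Latent p k)
    (u : Fin k → ℝ) :
    profileSampler O δ (z, u) = Measure.pi fun i => cellSampler O δ i (z i, u) := rfl

instance (O : LatentOracle G) (δ : ℝ) : IsMarkovKernel (profileSampler O δ) :=
  ⟨fun q => by
    rw [show q = (q.1, q.2) from rfl, profileSampler_apply]
    infer_instance⟩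

/-- The mechanism that the program implements. -/
def robustMechanism (M : Mechanism n m (Latent p k)) (O : LatentOracle G) (δ τ : ℝ) (c : ℝ≥0) :
    Mechanism n m (Latent p k) :=
  (Kernel.id ×ₖ (M ∘ₖ averaged (profileSampler O δ))).map
    fun q => robustOutput τ c q.1 (fun i => O.nearest i (q.1 i)) q.2

theorem measurable_robustOutput (O : LatentOracle G) (τ : ℝ) (c : ℝ≥0) :
    Measurable fun q : (Fin n → Latent p k) × Outcome n m =>
      robustOutput τ c q.1 (fun i => O.nearest i (q.1 i)) q.2 := by
  have hs : ∀ i : Fin n, MeasurableSet {q : (Fin n → Latent p k) × Outcome n m |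
      dist (q.1 i) (O.nearest i (q.1 i)) ≤ τ} := by
    intro i
    have := O.nearest_measurable i
    exact measurableSet_le (by fun_prop) measurable_const
  refine Measurable.prodMk (measurable_pi_lambda _ fun i => ?_)
    (measurable_pi_lambda _ fun i => ?_)
  · exact Measurable.ite (hs i) (by fun_prop) measurable_const
  · exact Measurable.ite (hs i) (by fun_prop) measurable_const

instance (M : Mechanism n m (Latent p k)) [IsMarkovKernel M] (O : LatentOracle G) (δ τ : ℝ)
    (c : ℝ≥0) : IsMarkovKernel (robustMechanism M O δ τ c) := by
  unfold robustMechanism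
  exact Kernel.IsMarkovKernel.map _ (measurable_robustOutput O τ c)

theorem robustMechanism_apply (M : Mechanism n m (Latent p k)) [IsMarkovKernel M]
    (O : LatentOracle G) (δ τ : ℝ) (c : ℝ≥0) (b : Fin n → Latent p k) :
    robustMechanism M O δ τ c b = ((averaged (profileSampler O δ) b).bind M).map
      (robustOutput τ c b fun i => O.nearest i (b i)) := by
  rw [robustMechanism, Kernel.map_apply _ (measurable_robustOutput O τ c), Kernel.prod_apply,
    Kernel.id_apply, Measure.dirac_prod, Measure.map_map (measurable_robustOutput O τ c)
    (by fun_prop), Kernel.comp_apply]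
  rfl

/-- Both sides are the same chain of random steps; associativity of `bind` for kernels identifies
them. -/
theorem isImplementedBy_robustProgram (M : Mechanism n m (Latent p k)) [IsMarkovKernel M]
    (O : LatentOracle G) (δ τ : ℝ) (c : ℝ≥0) :
    IsImplementedBy (robustMechanism M O δ τ c) (robustProgram m δ τ c) M O := by
  intro b
  have hout := measurable_robustOutput_right (m := m) τ c b fun i => O.nearest i (b i)
  have hm : Measurable fun u : Fin k → ℝ => (b, u) := by fun_prop
  have h : averaged (profileSampler O δ) b =
      (unitCube k).bind ((profileSampler O δ).comap _ hm) := averaged_apply _ b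
  rw [robustMechanism_apply, h, Measure.map_comp _ _ hout, Measure.comp_assoc]
  change _ = (unitCube k).bind fun u => (profileSampler O δ (b, u)).bind fun y =>
    (M y).bind fun o => Measure.dirac (robustOutput τ c b (fun i => O.nearest i (b i)) o)
  congr 1
  funext u
  rw [Kernel.comp_apply]
  congr 1
  funext y
  rw [Kernel.map_apply _ hout]
  exact (Measure.bind_dirac_eq_map _ hout).symm

end Construction

/-! ### The law of the resampled profile. -/

section ResampledProfiles

variable {n m k : ℕ} {p : ℝ≥0∞} [Fact (1 ≤ p)] {G : Fin n → Measure (Latent p k)}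

theorem LatentOracle.nearest_eq_self (O : LatentOracle G) (i : Fin n) {a : Latent p k}
    (ha : a ∈ (G i).support) : O.nearest i a = a := by
  have := O.nearest_le i a a ha
  rw [dist_self] at this
  exact (dist_le_zero.1 this).symm

/-- Rounding need not be continuous, but it is stable relative to support points. This suffices,
because in the Prokhorov comparison one of the two points can be taken in the support. -/
theorem LatentOracle.dist_nearest_le (O : LatentOracle G) (i : Fin n) {a b : Latent p k}
    (hb : b ∈ (G i).support) : dist (O.nearest i a) b ≤ 2 * dist a b := by
  have h1 := O.nearest_le i a b hb
  have h2 := dist_triangle_left (O.nearest i a) b a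
  linarith

/-- The box of the sampled report is the cell of the rounded report. -/
theorem cellSampler_eq_cond (O : LatentOracle G) {δ : ℝ} (hδ : 0 < δ) (i : Fin n)
    (a : Latent p k) (u : Fin k → ℝ)
    (h : G i (cellIndex δ u ⁻¹' {cellIndex δ u (O.nearest i a)}) ≠ 0) :
    cellSampler O δ i (a, u) =
      cond (G i) (cellIndex δ u ⁻¹' {cellIndex δ u (O.nearest i a)}) := by
  rw [← box_cellCorner hδ] at h ⊢
  exact O.draw_eq i _ _ h

/-- The points to which a report `b` of bidder `i` can be moved. -/
def nearPoints (O : LatentOracle G) (δ : ℝ) (i : Fin n) (b : Latent p k) : Set (Latent p k) :=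
  {a | a ∈ (G i).support ∧ ∀ j, |O.nearest i b j - a j| < δ}

theorem measurableSet_nearPoints (O : LatentOracle G) (δ : ℝ) (i : Fin n) (b : Latent p k) :
    MeasurableSet (nearPoints O δ i b) := by
  refine Measure.isClosed_support.measurableSet.inter ?_
  exact measurableSet_setOfPred.2 (Measurable.forall fun j => measurableSet_setOfPred.1
    (measurableSet_lt (by fun_prop) measurable_const))

/-- For almost every shift the cell of the rounded report has positive mass, so the sample is a
genuine conditional draw: it lies in the support and shares a cell of side `δ` with the rounded
report. -/
theorem ae_cellSampler_mem (O : LatentOracle G) {δ : ℝ} (hδ : 0 < δ) (i : Fin n)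
    (b : Latent p k) :
    ∀ᵐ u ∂(unitCube k), ∀ᵐ a ∂(cellSampler O δ i (b, u)), a ∈ nearPoints O δ i b := by
  filter_upwards [ae_measure_cell_ne_zero δ (O.nearest_mem i b)] with u hu
  rw [cellSampler_eq_cond O hδ i b u hu]
  have hms : MeasurableSet (cellIndex (p := p) δ u ⁻¹' {cellIndex δ u (O.nearest i b)}) := by
    have : Measurable (cellIndex (p := p) (k := k) δ u) :=
      (measurable_cellIndex δ).comp measurable_prodMk_left
    exact this (measurableSet_singleton _)
  filter_upwards [ae_cond_mem hms, (cond_absolutelyContinuous (μ := G i)).ae_le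
    (Measure.support_mem_ae (μ := G i))] with a h1 h2
  refine ⟨h2, fun j => ?_⟩
  rw [abs_sub_comm]
  exact abs_sub_apply_lt_of_cellIndex_eq hδ h1 j

theorem ae_averaged_cellSampler_mem (O : LatentOracle G) {δ : ℝ} (hδ : 0 < δ) (i : Fin n)
    (b : Latent p k) : ∀ᵐ a ∂(averaged (cellSampler O δ i) b), a ∈ nearPoints O δ i b :=
  ae_averaged _ _ (measurableSet_nearPoints O δ i b) (ae_cellSampler_mem O hδ i b)

theorem ae_averaged_profileSampler_mem (O : LatentOracle G) {δ : ℝ} (hδ : 0 < δ)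
    (b : Fin n → Latent p k) :
    ∀ᵐ y ∂(averaged (profileSampler O δ) b), ∀ i, y i ∈ nearPoints O δ i (b i) := by
  have hms : MeasurableSet {y : Fin n → Latent p k | ∀ i, y i ∈ nearPoints O δ i (b i)} := by
    have : {y : Fin n → Latent p k | ∀ i, y i ∈ nearPoints O δ i (b i)} =
        ⋂ i, {y | y i ∈ nearPoints O δ i (b i)} := by
      ext y; simp
    exact this ▸ MeasurableSet.iInter fun i =>
      measurable_pi_apply i (measurableSet_nearPoints O δ i (b i))
  refine ae_averaged _ _ hms ?_
  filter_upwards [ae_all_iff.2 fun i => ae_cellSampler_mem O hδ i (b i)] with u hu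
  rw [profileSampler_apply]
  exact ae_all_iff.2 fun i =>
    (measurePreserving_eval (fun i => cellSampler O δ i (b i, u)) i).quasiMeasurePreserving.ae
      (hu i)

/-- Changing one report changes means over the resampled profile by at most the probability that
the random grid separates the rounded reports. -/
theorem abs_integral_averaged_update_sub_le (O : LatentOracle G) {δ : ℝ} (hδ : 0 < δ)
    {f : (Fin n → Latent p k) → ℝ} (hf : Measurable f) {B : ℝ} (hB : ∀ y, |f y| ≤ B)
    (z : Fin n → Latent p k) (j : Fin n) (a b : Latent p k) :
    |∫ y, f y ∂(averaged (profileSampler O δ) (Function.update z j a)) -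
      ∫ y, f y ∂(averaged (profileSampler O δ) (Function.update z j b))| ≤
      4 * B * (∑ l, |O.nearest j a l - O.nearest j b l|) / δ := by
  have hB0 : 0 ≤ B := (abs_nonneg _).trans (hB z)
  have hint : ∀ (μ : Measure (Fin n → Latent p k)) [IsFiniteMeasure μ], Integrable f μ :=
    fun μ _ => integrable_of_measurable_of_bounded hf hB
  rw [integral_averaged _ _ (hint _), integral_averaged _ _ (hint _)]
  set h : Latent p k → (Fin k → ℝ) → ℝ := fun a u =>
    ∫ y, f y ∂(profileSampler O δ (Function.update z j a, u)) with hh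
  have hhm : ∀ a, Measurable (h a) := fun a =>
    (measurable_integral_kernel (profileSampler O δ) hf).comp measurable_prodMk_left
  have hhB : ∀ a u, |h a u| ≤ B := fun a u => abs_integral_le_of_bounded (ae_of_all _ hB)
  have hhi : ∀ a, Integrable (h a) (unitCube k) := fun a =>
    integrable_of_measurable_of_bounded (hhm a) (hhB a)
  change |∫ u, h a u ∂(unitCube k) - ∫ u, h b u ∂(unitCube k)| ≤ _
  rw [← integral_sub (hhi a) (hhi b)]
  -- On the event `E` of separation the two conditional means differ by at most `2B`; off `E` the
  -- resampled profiles have the same law. Since `E` has probability at most twice the `ℓ_1`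
  -- distance over `δ`, the constant is `4B`.
  set E := {u : Fin k → ℝ | cellIndex δ u (O.nearest j a) ≠ cellIndex δ u (O.nearest j b)}
    with hE
  have hEm : MeasurableSet E := by
    have hx : ∀ x : Latent p k, Measurable fun u => cellIndex δ u x := fun x =>
      (measurable_cellIndex δ).comp measurable_prodMk_right
    exact (measurableSet_eq_fun (hx _) (hx _)).compl
  have hpt : ∀ u, |h a u - h b u| ≤ E.indicator (fun _ => 2 * B) u := by
    intro u
    by_cases hu : u ∈ E
    · rw [Set.indicator_of_mem hu]
      have := abs_sub (h a u) (h b u)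
      linarith [hhB a u, hhB b u]
    · rw [Set.indicator_of_notMem hu]
      have hu' : cellIndex δ u (O.nearest j a) = cellIndex δ u (O.nearest j b) := by
        simpa [hE] using hu
      have : h a u = h b u := by
        simp only [hh, profileSampler_apply]
        congr 2
        funext i
        by_cases hi : i = j
        · subst hi
          simpa using cellSampler_congr O δ i hu'
        · simp [hi]
      simp [this]
  refine (abs_integral_le_integral_abs).trans ?_
  refine (integral_mono ((hhi a).sub (hhi b)).abs
    ((integrable_const _).indicator hEm) hpt).trans ?_
  rw [integral_indicator_const _ hEm, smul_eq_mul]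
  calc _ ≤ 2 * (∑ l, |O.nearest j a l - O.nearest j b l|) / δ * (2 * B) :=
        mul_le_mul_of_nonneg_right (unitCube_cellIndex_ne_le hδ _ _) (by positivity)
    _ = _ := by ring

/-- Given the shift, the coordinates are resampled independently, so the resampled law is a mixture
over shifts of product measures. -/
theorem bind_averaged_profileSampler_pi (O : LatentOracle G) (δ : ℝ)
    (F : Fin n → Measure (Latent p k)) [∀ i, IsProbabilityMeasure (F i)]
    {s : Fin n → Set (Latent p k)} (hs : ∀ i, MeasurableSet (s i)) :
    (Measure.pi F).bind (averaged (profileSampler O δ)) (Set.univ.pi s) =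
      ∫⁻ u, ∏ i, (F i).bind (fun a => cellSampler O δ i (a, u)) (s i) ∂(unitCube k) := by
  have hS := MeasurableSet.univ_pi hs
  rw [Measure.bind_apply hS (Kernel.aemeasurable _)]
  simp_rw [averaged_apply' _ _ hS]
  rw [lintegral_lintegral_swap ((profileSampler O δ).measurable_coe hS).aemeasurable]
  refine lintegral_congr fun u => ?_
  simp_rw [profileSampler_apply, Measure.pi_pi]
  have hm : ∀ i, Measurable fun a => cellSampler O δ i (a, u) := fun i =>
    (cellSampler O δ i).measurable.comp measurable_prodMk_right
  rw [lintegral_pi_prod F (g := fun i a => cellSampler O δ i (a, u) (s i))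
    fun i => (Measure.measurable_coe (hs i)).comp (hm i)]
  exact Finset.prod_congr rfl fun i _ => (Measure.bind_apply (hs i) (hm i).aemeasurable).symm

variable [∀ i, IsProbabilityMeasure (G i)]

/-- Almost every point of `G i` lies in the support and is its own rounding, so the sampler redraws
it from its own cell. -/
theorem bind_cellSampler_eq (O : LatentOracle G) {δ : ℝ} (hδ : 0 < δ) (i : Fin n)
    (u : Fin k → ℝ) : (G i).bind (fun a => cellSampler O δ i (a, u)) = G i := by
  have hm : Measurable fun a : Latent p k => (cellCorner δ u a, fun _ : Fin k => δ) :=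
    ((measurable_cellCorner δ).comp measurable_prodMk_left).prodMk measurable_const
  have h1 : (G i).bind (fun a => cellSampler O δ i (a, u)) =
      (G i).bind fun a => O.draw i (cellCorner δ u a, fun _ => δ) := by
    refine Measure.bind_congr_right ?_
    filter_upwards [Measure.support_mem_ae (μ := G i)] with a ha
    rw [cellSampler_apply, O.nearest_eq_self i ha]
  rw [h1]
  refine bind_cond_preimage_eq (c := cellIndex δ u)
    ((measurable_cellIndex δ).comp measurable_prodMk_left) ((O.draw i).measurable.comp hm) ?_
  intro a ha
  rw [← box_cellCorner hδ] at ha ⊢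
  exact O.draw_eq i _ _ ha

/-- Resampling preserves the product of the oracle's distributions. -/
theorem bind_averaged_profileSampler_eq (O : LatentOracle G) {δ : ℝ} (hδ : 0 < δ) :
    (Measure.pi G).bind (averaged (profileSampler O δ)) = Measure.pi G := by
  refine (Measure.pi_eq fun s hs => ?_).symm
  rw [bind_averaged_profileSampler_pi O δ G hs]
  simp [bind_cellSampler_eq O hδ]

/-- The common shift does not correlate the coordinates here: for every shift the factors `j ≠ i`
are exactly `G j`, so the mixture over shifts affects factor `i` alone. -/
theorem bind_averaged_profileSampler_update_eq (O : LatentOracle G) {δ : ℝ} (hδ : 0 < δ)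
    (i : Fin n) (r : Latent p k) :
    (Measure.pi (Function.update G i (Measure.dirac r))).bind (averaged (profileSampler O δ)) =
      Measure.pi (Function.update G i (averaged (cellSampler O δ i) r)) := by
  have := isProbabilityMeasure_update G i (Measure.dirac r)
  have := isProbabilityMeasure_update G i (averaged (cellSampler O δ i) r)
  refine (Measure.pi_eq fun s hs => ?_).symm
  rw [bind_averaged_profileSampler_pi O δ _ hs,
    ← Finset.mul_prod_erase _ _ (Finset.mem_univ i), Function.update_self,
    averaged_apply' _ _ (hs i)]
  have h1 : ∀ j ∈ Finset.univ.erase i, ∀ u : Fin k → ℝ,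
      (Function.update G i (Measure.dirac r) j).bind (fun a => cellSampler O δ j (a, u)) (s j) =
        Function.update G i (averaged (cellSampler O δ i) r) j (s j) := by
    intro j hj u
    have hj' := (Finset.mem_erase.1 hj).1
    rw [Function.update_of_ne hj', Function.update_of_ne hj', bind_cellSampler_eq O hδ]
  have h2 : ∀ u : Fin k → ℝ,
      (Function.update G i (Measure.dirac r) i).bind (fun a => cellSampler O δ i (a, u)) (s i) =
        cellSampler O δ i (r, u) (s i) := by
    intro u
    rw [Function.update_self, Measure.dirac_bind
      (f := fun a => cellSampler O δ i (a, u))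
      ((cellSampler O δ i).measurable.comp measurable_prodMk_right)]
  have h3 : ∀ u : Fin k → ℝ,
      ∏ j, (Function.update G i (Measure.dirac r) j).bind
        (fun a => cellSampler O δ j (a, u)) (s j) =
      cellSampler O δ i (r, u) (s i) *
        ∏ j ∈ Finset.univ.erase i, Function.update G i (averaged (cellSampler O δ i) r) j (s j) := by
    intro u
    rw [← Finset.mul_prod_erase _ _ (Finset.mem_univ i), h2]
    congr 1
    exact Finset.prod_congr rfl fun j hj => h1 j hj u
  simp_rw [h3]
  rw [lintegral_mul_const]
  exact ((cellSampler O δ i).measurable_coe (hs i)).comp measurable_prodMk_left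

end ResampledProfiles

/-! ### Transfer of means between Prokhorov-close distributions. -/

section Robustness

variable {n m k : ℕ} {p : ℝ≥0∞} [Fact (1 ≤ p)] {G : Fin n → Measure (Latent p k)}
  [∀ i, IsProbabilityMeasure (G i)]

/-- Resampling makes the mean of `f` nearly Lipschitz in the report `a` when it is compared with
support points, so the test-function form of Prokhorov closeness applies although `f` is only
bounded and measurable. -/
theorem integral_averaged_update_sub_le (O : LatentOracle G) {δ : ℝ} (hδ : 0 < δ)
    {f : (Fin n → Latent p k) → ℝ} (hf : Measurable f) {B : ℝ} (hB : ∀ y, |f y| ≤ B)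
    (z : Fin n → Latent p k) (j : Fin n) {F : Measure (Latent p k)} [IsProbabilityMeasure F]
    {ζ : ℝ} (hζ : levyProkhorovDist F (G j) ≤ ζ) :
    ∫ a, ∫ y, f y ∂(averaged (profileSampler O δ) (Function.update z j a)) ∂F -
      ∫ a, ∫ y, f y ∂(averaged (profileSampler O δ) (Function.update z j a)) ∂(G j) ≤
      8 * B * (1 + (k : ℝ) ^ (1 - 1 / p.toReal) / δ) * ζ := by
  have hB0 : 0 ≤ B := (abs_nonneg _).trans (hB z)
  set Λ : ℝ := (k : ℝ) ^ (1 - 1 / p.toReal) with hΛ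
  have hΛ0 : 0 ≤ Λ := by positivity
  set φ : Latent p k → ℝ := fun a =>
    ∫ y, f y ∂(averaged (profileSampler O δ) (Function.update z j a)) with hφ
  have hφm : Measurable φ :=
    (measurable_integral_kernel (averaged (profileSampler O δ)) hf).comp
      (measurable_update z (a := j))
  have hφB : ∀ a, |φ a| ≤ B := fun a => abs_integral_le_of_bounded (ae_of_all _ hB)
  have hφi : ∀ (μ : Measure (Latent p k)) [IsFiniteMeasure μ], Integrable φ μ :=
    fun μ _ => integrable_of_measurable_of_bounded hφm hφB
  have hε : ∀ ε, ζ < ε →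
      ∫ a, φ a ∂F - ∫ a, φ a ∂(G j) ≤ 8 * B * (1 + Λ / δ) * ε := by
    intro ε hε
    have hε0 : 0 ≤ ε := (ENNReal.toReal_nonneg.trans hζ).trans hε.le
    -- Adding `B` makes the test function take values in `[0, 2B]`. Roundings of points at distance
    -- less than `ε` are within `2ε`, and this turns the separation bound `4B · Λ · 2ε / δ` into
    -- `κ`.
    have hLP := integral_le_of_levyProkhorovDist_lt (hζ.trans_lt hε) (hφm.add_const B)
      (hφm.add_const B) (R := 2 * B) (κ := 8 * B * (Λ / δ) * ε)
      (fun a => by linarith [neg_abs_le (φ a), hφB a])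
      (fun a => by linarith [le_abs_self (φ a), hφB a])
      (fun a => by linarith [neg_abs_le (φ a), hφB a])
      (fun a => by linarith [le_abs_self (φ a), hφB a])
      (by positivity) (Measure.support_mem_ae (μ := G j)) fun x y hy hxy => by
        have h1 := (le_abs_self _).trans (abs_integral_averaged_update_sub_le O hδ hf hB z j x y)
        have h2 := sum_abs_sub_le_rpow_mul_dist (O.nearest j x) (O.nearest j y)
        have h3 : dist (O.nearest j x) (O.nearest j y) ≤ 2 * ε := by
          rw [O.nearest_eq_self j hy]
          exact (O.dist_nearest_le j hy).trans (by linarith)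
        have h4 : 4 * B * (∑ l, |O.nearest j x l - O.nearest j y l|) / δ ≤
            8 * B * (Λ / δ) * ε := by
          calc _ ≤ 4 * B * (Λ * (2 * ε)) / δ := by
                gcongr
                exact h2.trans (mul_le_mul_of_nonneg_left h3 hΛ0)
            _ = _ := by ring
        change φ x - φ y ≤ _ at h1
        linarith
    rw [integral_add (hφi F) (integrable_const B), integral_add (hφi (G j)) (integrable_const B)]
      at hLP
    simp only [integral_const, probReal_univ, one_smul] at hLP
    nlinarith [mul_nonneg hB0 hε0]
  -- The Prokhorov comparison needs `ε > ζ` strictly, so `ε` is taken to decrease to `ζ`. The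
  -- denominator `D + 1` below allows `D = 0`.
  refine le_of_forall_pos_le_add fun e he => ?_
  set D : ℝ := 8 * B * (1 + Λ / δ) with hD
  have hD0 : 0 ≤ D := by positivity
  refine (hε (ζ + e / (D + 1)) (by linarith [show 0 < e / (D + 1) by positivity])).trans ?_
  have : D * (e / (D + 1)) ≤ e := by
    rw [mul_div_assoc', div_le_iff₀ (by positivity)]
    nlinarith
  linarith

theorem abs_integral_averaged_update_sub_le' (O : LatentOracle G) {δ : ℝ} (hδ : 0 < δ)
    {f : (Fin n → Latent p k) → ℝ} (hf : Measurable f) {B : ℝ} (hB : ∀ y, |f y| ≤ B)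
    (z : Fin n → Latent p k) (j : Fin n) {F : Measure (Latent p k)} [IsProbabilityMeasure F]
    {ζ : ℝ} (hζ : levyProkhorovDist F (G j) ≤ ζ) :
    |∫ a, ∫ y, f y ∂(averaged (profileSampler O δ) (Function.update z j a)) ∂F -
      ∫ a, ∫ y, f y ∂(averaged (profileSampler O δ) (Function.update z j a)) ∂(G j)| ≤
      8 * B * (1 + (k : ℝ) ^ (1 - 1 / p.toReal) / δ) * ζ := by
  refine abs_le.2 ⟨?_, integral_averaged_update_sub_le O hδ hf hB z j hζ⟩
  have := integral_averaged_update_sub_le O hδ hf.neg (fun y => by simpa using hB y) z j hζ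
  simp only [Pi.neg_apply, integral_neg] at this
  linarith

end Robustness

/-! ### Regular valuations. -/

/-- A valuation over latent types that is normalized and, with constant `H`, Lipschitz for the
largest coordinate difference. -/
structure IsRegularValuation {m k : ℕ} {p : ℝ≥0∞} (H : ℝ)
    (w : Latent p k → Set (Fin m) → ℝ≥0) : Prop where
  abs_sub_le : ∀ (x y : Latent p k) (D : ℝ), (∀ j, |x j - y j| ≤ D) → ∀ S,
    |(w x S : ℝ) - w y S| ≤ H * D
  zero : ∀ S, w 0 S = 0
  empty : ∀ x, w x ∅ = 0

theorem isRegularValuation_latentValuation {d m k : ℕ} (p : ℝ≥0∞) {L : ℝ} (hL : 0 ≤ L)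
    (A : Matrix (Fin d) (Fin k) ℝ) {v : (Fin d → ℝ) → Set (Fin m) → ℝ≥0}
    (hv : IsLipschitzValuation L v) (hv0 : ∀ S, v 0 S = 0) (hve : ∀ t, v t ∅ = 0) :
    IsRegularValuation (k * L * maxEntry A) (latentValuation p A v) where
  abs_sub_le _ _ _ h S := abs_latentValuation_sub_le hL A hv h S
  zero S := by simp [latentValuation, hv0]
  empty x := hve _

section Valuations

variable {m k : ℕ} {p : ℝ≥0∞} {H : ℝ} {w : Latent p k → Set (Fin m) → ℝ≥0}

theorem IsRegularValuation.le (hw : IsRegularValuation H w) {x : Latent p k} {D : ℝ}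
    (h : ∀ j, |x j| ≤ D) (S : Set (Fin m)) : (w x S : ℝ) ≤ H * D := by
  have := (le_abs_self _).trans (hw.abs_sub_le x 0 D (by simpa using h) S)
  simpa [hw.zero] using this

theorem IsRegularValuation.le_norm [Fact (1 ≤ p)] (hw : IsRegularValuation H w) (x : Latent p k)
    (S : Set (Fin m)) : (w x S : ℝ) ≤ H * ‖x‖ :=
  hw.le (fun j => PiLp.norm_apply_le x j) S

end Valuations

/-! ### Payoffs after the discount, and the bounds that follow from IR. -/

section Payoffs

variable {n m k : ℕ} {p : ℝ≥0∞}

/-- The expected payoff of bidder `i` of type `t` at reports `y` when her payment is reduced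
by `c`. -/
def discountedUtility (M : Mechanism n m (Latent p k)) (w : Latent p k → Set (Fin m) → ℝ≥0)
    (c : ℝ≥0) (i : Fin n) (t : Latent p k) (y : Fin n → Latent p k) : ℝ :=
  ∫ o, ((w t (o.1 i) : ℝ) - ((o.2 i - c : ℝ≥0) : ℝ)) ∂(M y)

theorem measurable_bundle {α : Type*} [MeasurableSpace α] (f : Set (Fin m) → α) (i : Fin n) :
    Measurable fun o : Outcome n m => f (o.1 i) :=
  (measurable_of_countable f).comp (by fun_prop)

theorem measurable_discountedUtility (M : Mechanism n m (Latent p k)) [IsMarkovKernel M]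
    (w : Latent p k → Set (Fin m) → ℝ≥0) (c : ℝ≥0) (i : Fin n) (t : Latent p k) :
    Measurable (discountedUtility M w c i t) := by
  have h := measurable_bundle (n := n) (w t) i
  exact measurable_integral_kernel M (by fun_prop)

theorem measurable_utility (M : Mechanism n m (Latent p k)) [IsMarkovKernel M]
    (w : Latent p k → Set (Fin m) → ℝ≥0) (i : Fin n) (t : Latent p k) :
    Measurable (utility M w i t) := by
  have h := measurable_bundle (n := n) (w t) i
  exact measurable_integral_kernel M (by fun_prop)

theorem HasPaymentRule.ae_eq {M : Mechanism n m (Latent p k)} (hM : HasPaymentRule M)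
    (y : Fin n → Latent p k) : ∃ q : Fin n → ℝ≥0, ∀ i, ∀ᵐ o ∂(M y), o.2 i = q i := by
  obtain ⟨q, hq⟩ := hM y
  exact ⟨q, fun i => hq.mono fun o ho => by rw [ho]⟩

variable [Fact (1 ≤ p)] {H : ℝ} {w : Latent p k → Set (Fin m) → ℝ≥0}

theorem IsRegularValuation.integrable_bundle (hw : IsRegularValuation H w) (t : Latent p k)
    (i : Fin n) (μ : Measure (Outcome n m)) [IsFiniteMeasure μ] :
    Integrable (fun o => (w t (o.1 i) : ℝ)) μ := by
  have h := measurable_bundle (n := n) (w t) i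
  refine integrable_of_measurable_of_bounded (B := H * ‖t‖) (by fun_prop) fun o => ?_
  rw [abs_of_nonneg (NNReal.coe_nonneg _)]
  exact hw.le_norm t _

theorem integrable_payment_of_ae_le {μ : Measure (Outcome n m)} [IsFiniteMeasure μ] {i : Fin n}
    {B : ℝ} (h : ∀ᵐ o ∂μ, (o.2 i : ℝ) ≤ B) : Integrable (fun o => (o.2 i : ℝ)) μ := by
  refine Integrable.of_bound (C := B) (by fun_prop) (h.mono fun o ho => ?_)
  rwa [Real.norm_of_nonneg (NNReal.coe_nonneg _)]

theorem integrable_discounted_payment_of_ae_le {μ : Measure (Outcome n m)} [IsFiniteMeasure μ]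
    {i : Fin n} {B : ℝ} (c : ℝ≥0) (h : ∀ᵐ o ∂μ, (o.2 i : ℝ) ≤ B) :
    Integrable (fun o => ((o.2 i - c : ℝ≥0) : ℝ)) μ := by
  refine Integrable.of_bound (C := B) (by fun_prop) (h.mono fun o ho => ?_)
  rw [Real.norm_of_nonneg (NNReal.coe_nonneg _)]
  exact (NNReal.coe_le_coe.2 tsub_le_self).trans ho

variable {M : Mechanism n m (Latent p k)} [IsMarkovKernel M]

theorem utility_eq_of_ae_eq (hw : IsRegularValuation H w) {i : Fin n} {y : Fin n → Latent p k}
    {q : ℝ≥0} (hq : ∀ᵐ o ∂(M y), o.2 i = q) (t : Latent p k) :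
    utility M w i t y = ∫ o, (w t (o.1 i) : ℝ) ∂(M y) - q := by
  have h1 : utility M w i t y = ∫ o, ((w t (o.1 i) : ℝ) - q) ∂(M y) :=
    integral_congr_ae (hq.mono fun o ho => by simp only [ho])
  rw [h1, integral_sub (hw.integrable_bundle t i _) (integrable_const _)]
  simp

theorem discountedUtility_eq_of_ae_eq (hw : IsRegularValuation H w) {i : Fin n}
    {y : Fin n → Latent p k} {q : ℝ≥0} (hq : ∀ᵐ o ∂(M y), o.2 i = q) (c : ℝ≥0)
    (t : Latent p k) :
    discountedUtility M w c i t y = ∫ o, (w t (o.1 i) : ℝ) ∂(M y) - ((q - c : ℝ≥0) : ℝ) := by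
  have h1 : discountedUtility M w c i t y =
      ∫ o, ((w t (o.1 i) : ℝ) - ((q - c : ℝ≥0) : ℝ)) ∂(M y) :=
    integral_congr_ae (hq.mono fun o ho => by simp only [ho])
  rw [h1, integral_sub (hw.integrable_bundle t i _) (integrable_const _)]
  simp

theorem coe_tsub_eq_max (a b : ℝ≥0) : ((a - b : ℝ≥0) : ℝ) = max ((a : ℝ) - b) 0 := by
  exact NNReal.coe_sub_def

theorem utility_le_discountedUtility (hM : HasPaymentRule M) (hw : IsRegularValuation H w)
    (c : ℝ≥0) (i : Fin n) (t : Latent p k) (y : Fin n → Latent p k) :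
    utility M w i t y ≤ discountedUtility M w c i t y := by
  obtain ⟨q, hq⟩ := hM.ae_eq y
  rw [utility_eq_of_ae_eq hw (hq i), discountedUtility_eq_of_ae_eq hw (hq i)]
  have : ((q i - c : ℝ≥0) : ℝ) ≤ q i := NNReal.coe_le_coe.2 tsub_le_self
  linarith

theorem discountedUtility_le_utility_add (hM : HasPaymentRule M) (hw : IsRegularValuation H w)
    (c : ℝ≥0) (i : Fin n) (t : Latent p k) (y : Fin n → Latent p k) :
    discountedUtility M w c i t y ≤ utility M w i t y + c := by
  obtain ⟨q, hq⟩ := hM.ae_eq y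
  rw [utility_eq_of_ae_eq hw (hq i), discountedUtility_eq_of_ae_eq hw (hq i), coe_tsub_eq_max]
  linarith [le_max_left ((q i : ℝ) - c) 0]

theorem integral_bundle_le_add (hw : IsRegularValuation H w) {x y : Latent p k} {D : ℝ}
    (h : ∀ j, |x j - y j| ≤ D) (i : Fin n) (μ : Measure (Outcome n m)) [IsProbabilityMeasure μ] :
    ∫ o, (w x (o.1 i) : ℝ) ∂μ ≤ ∫ o, (w y (o.1 i) : ℝ) ∂μ + H * D := by
  have h1 : ∫ o, (w x (o.1 i) : ℝ) ∂μ ≤ ∫ o, ((w y (o.1 i) : ℝ) + H * D) ∂μ :=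
    integral_mono (hw.integrable_bundle x i μ)
      ((hw.integrable_bundle y i μ).add (integrable_const _)) fun o => by
        have := (le_abs_self _).trans (hw.abs_sub_le x y D h (o.1 i))
        linarith
  rw [integral_add (hw.integrable_bundle y i μ) (integrable_const _)] at h1
  simpa using h1

theorem utility_le_utility_add (hM : HasPaymentRule M) (hw : IsRegularValuation H w)
    {x y : Latent p k} {D : ℝ} (h : ∀ j, |x j - y j| ≤ D) (i : Fin n) (b : Fin n → Latent p k) :
    utility M w i x b ≤ utility M w i y b + H * D := by
  obtain ⟨q, hq⟩ := hM.ae_eq b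
  rw [utility_eq_of_ae_eq hw (hq i), utility_eq_of_ae_eq hw (hq i)]
  linarith [integral_bundle_le_add hw h i (M b)]

/-- A bidder whose type is close to the profile's entry does not lose. -/
theorem discountedUtility_nonneg (hM : HasPaymentRule M) (hw : IsRegularValuation H w)
    {i : Fin n} {y : Fin n → Latent p k} (hy : 0 ≤ utility M w i (y i) y) {t : Latent p k}
    {D : ℝ} (h : ∀ j, |y i j - t j| ≤ D) {c : ℝ≥0} (hc : H * D ≤ c) :
    0 ≤ discountedUtility M w c i t y := by
  obtain ⟨q, hq⟩ := hM.ae_eq y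
  rw [discountedUtility_eq_of_ae_eq hw (hq i), coe_tsub_eq_max]
  rw [utility_eq_of_ae_eq hw (hq i)] at hy
  have h0 : 0 ≤ ∫ o, (w t (o.1 i) : ℝ) ∂(M y) := integral_nonneg fun o => NNReal.coe_nonneg _
  have h1 := integral_bundle_le_add hw h i (M y)
  -- Either the whole discount is granted and pays for the loss in value, or nothing is paid. The
  -- payment is a constant given the profile, so truncating it at zero commutes with the
  -- expectation.
  rcases max_cases ((q i : ℝ) - c) 0 with ⟨hmax, -⟩ | ⟨hmax, -⟩ <;> rw [hmax] <;> linarith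

theorem integral_bundle_le (hw : IsRegularValuation H w) {t : Latent p k} {D : ℝ}
    (h : ∀ j, |t j| ≤ D) (i : Fin n) (μ : Measure (Outcome n m)) [IsProbabilityMeasure μ] :
    ∫ o, (w t (o.1 i) : ℝ) ∂μ ≤ H * D := by
  have := integral_mono (hw.integrable_bundle t i μ) (integrable_const (H * D))
    fun o => hw.le h (o.1 i)
  simpa using this

/-- Individual rationality bounds the payments. -/
theorem ae_payment_le (hM : HasPaymentRule M) (hw : IsRegularValuation H w) {i : Fin n}
    {y : Fin n → Latent p k} (hy : 0 ≤ utility M w i (y i) y) (hy1 : ∀ j, |y i j| ≤ 1) :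
    ∀ᵐ o ∂(M y), (o.2 i : ℝ) ≤ H := by
  obtain ⟨q, hq⟩ := hM.ae_eq y
  rw [utility_eq_of_ae_eq hw (hq i)] at hy
  have := integral_bundle_le hw hy1 i (M y)
  filter_upwards [hq i] with o ho
  rw [ho]
  linarith

/-- IR at the profile caps the payment by the value of the entry `y i`, hence by `H`; this bounds
the payoff of every type `t`, not only of `y i`. -/
theorem abs_utility_le (hM : HasPaymentRule M) (hw : IsRegularValuation H w) {i : Fin n}
    {y : Fin n → Latent p k} (hy : 0 ≤ utility M w i (y i) y) (hy1 : ∀ j, |y i j| ≤ 1)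
    {t : Latent p k} {D : ℝ} (ht : ∀ j, |t j| ≤ D) {B : ℝ} (hHB : H ≤ B) (hB : H * D ≤ B) :
    |utility M w i t y| ≤ B := by
  obtain ⟨q, hq⟩ := hM.ae_eq y
  rw [utility_eq_of_ae_eq hw (hq i)] at hy ⊢
  have h1 := integral_bundle_le hw hy1 i (M y)
  have h2 := integral_bundle_le hw ht i (M y)
  have h0 : 0 ≤ ∫ o, (w t (o.1 i) : ℝ) ∂(M y) := integral_nonneg fun o => NNReal.coe_nonneg _
  rw [abs_le]
  constructor <;> linarith [NNReal.coe_nonneg (q i)]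

theorem abs_discountedUtility_le (hM : HasPaymentRule M) (hw : IsRegularValuation H w) {i : Fin n}
    {y : Fin n → Latent p k} (hy : 0 ≤ utility M w i (y i) y) (hy1 : ∀ j, |y i j| ≤ 1) (c : ℝ≥0)
    {t : Latent p k} {D : ℝ} (ht : ∀ j, |t j| ≤ D) {B : ℝ} (hHB : H ≤ B) (hB : H * D ≤ B) :
    |discountedUtility M w c i t y| ≤ B := by
  have h1 := utility_le_discountedUtility hM hw c i t y
  have h2 := (abs_le.1 (abs_utility_le hM hw hy hy1 ht hHB hB)).1
  obtain ⟨q, hq⟩ := hM.ae_eq y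
  have h3 := integral_bundle_le hw ht i (M y)
  refine abs_le.2 ⟨h2.trans h1, ?_⟩
  rw [discountedUtility_eq_of_ae_eq hw (hq i)]
  linarith [NNReal.coe_nonneg (q i - c)]

end Payoffs

/-! ### Profiles of support points. -/

section Support

variable {n k : ℕ} {p : ℝ≥0∞} {G : Fin n → Measure (Latent p k)}

theorem ae_pi_mem_support [∀ i, IsProbabilityMeasure (G i)] :
    ∀ᵐ s ∂(Measure.pi G), ∀ i, s i ∈ (G i).support :=
  ae_all_iff.2 fun i => (measurePreserving_eval G i).quasiMeasurePreserving.ae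
    (Measure.support_mem_ae (μ := G i))

theorem measurableSet_pi_support :
    MeasurableSet {y : Fin n → Latent p k | ∀ i, y i ∈ (G i).support} :=
  measurableSet_setOfPred.2 (Measurable.forall fun i => measurableSet_setOfPred.1
    (measurable_pi_apply i (Measure.isClosed_support (μ := G i)).measurableSet))

end Support

/-! ### Feasibility, utilities and individual rationality of the robust mechanism. -/

section Robust

variable {n m k : ℕ} {p : ℝ≥0∞} [Fact (1 ≤ p)] {G : Fin n → Measure (Latent p k)}
  {M : Mechanism n m (Latent p k)} [IsMarkovKernel M]

/-- Dropping a bidder replaces her bundle by `∅`, which only decreases the queried allocation. -/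
theorem robustMechanism_ae_mem_of_isLowerSet (O : LatentOracle G) (δ τ : ℝ) (c : ℝ≥0)
    {K : Set (Allocation n m)} (hK : IsLowerSet K) (h : ∀ b, ∀ᵐ o ∂(M b), o.1 ∈ K)
    (b : Fin n → Latent p k) : ∀ᵐ o ∂(robustMechanism M O δ τ c b), o.1 ∈ K := by
  have hms : MeasurableSet {o : Outcome n m | o.1 ∈ K} :=
    measurable_fst (Set.toFinite K).measurableSet
  rw [robustMechanism_apply, ae_map_iff (measurable_robustOutput_right _ _ _ _).aemeasurable hms]
  refine (Measure.ae_comp_of_ae_ae hms (ae_of_all _ h)).mono fun o ho => hK ?_ ho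
  intro i
  by_cases hi : dist (b i) (O.nearest i (b i)) ≤ τ <;> simp [robustOutput, hi]

theorem utility_robustMechanism (O : LatentOracle G) (δ τ : ℝ) (c : ℝ≥0)
    (w : Latent p k → Set (Fin m) → ℝ≥0) (i : Fin n) (t : Latent p k) (b : Fin n → Latent p k) :
    utility (robustMechanism M O δ τ c) w i t b =
      ∫ o, ((w t ((robustOutput τ c b (fun i => O.nearest i (b i)) o).1 i) : ℝ) -
        ((robustOutput τ c b (fun i => O.nearest i (b i)) o).2 i : ℝ))
          ∂((averaged (profileSampler O δ) b).bind M) := by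
  have h := measurable_bundle (n := n) (w t) i
  have hm : Measurable fun o : Outcome n m => (w t (o.1 i) : ℝ) - (o.2 i : ℝ) := by fun_prop
  rw [utility, robustMechanism_apply,
    integral_map (measurable_robustOutput_right _ _ _ _).aemeasurable hm.aestronglyMeasurable]

variable {H : ℝ} {w : Fin n → Latent p k → Set (Fin m) → ℝ≥0}

theorem utility_robustMechanism_of_not_le (O : LatentOracle G) (δ τ : ℝ) (c : ℝ≥0)
    {w : Latent p k → Set (Fin m) → ℝ≥0} (hw : IsRegularValuation H w) {i : Fin n}
    (t : Latent p k) {b : Fin n → Latent p k} (hi : ¬ dist (b i) (O.nearest i (b i)) ≤ τ) :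
    utility (robustMechanism M O δ τ c) w i t b = 0 := by
  rw [utility_robustMechanism]
  simp [robustOutput, hi, hw.empty]

/-- The outcomes queried at resampled profiles have payments at most `H`. -/
theorem ae_queried_payment_le (O : LatentOracle G) {δ : ℝ} (hδ : 0 < δ) (hM : HasPaymentRule M)
    (hw : ∀ i, IsRegularValuation H (w i))
    (hG : ∀ i, ∀ a ∈ (G i).support, ∀ j, |a j| ≤ 1)
    (hIR : IsIR M w fun i => (G i).support) (b : Fin n → Latent p k) (i : Fin n) :
    ∀ᵐ o ∂((averaged (profileSampler O δ) b).bind M), (o.2 i : ℝ) ≤ H := by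
  refine Measure.ae_comp_of_ae_ae (measurableSet_le (by fun_prop) measurable_const) ?_
  filter_upwards [ae_averaged_profileSampler_mem O hδ b] with y hy
  exact ae_payment_le hM (hw i) (hIR y (fun i => (hy i).1) i).2 (hG i _ (hy i).1)

theorem utility_robustMechanism_of_le (O : LatentOracle G) {δ : ℝ} (hδ : 0 < δ) (τ : ℝ) (c : ℝ≥0)
    (hM : HasPaymentRule M) (hw : ∀ i, IsRegularValuation H (w i))
    (hG : ∀ i, ∀ a ∈ (G i).support, ∀ j, |a j| ≤ 1)
    (hIR : IsIR M w fun i => (G i).support) {i : Fin n} (t : Latent p k)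
    {b : Fin n → Latent p k} (hi : dist (b i) (O.nearest i (b i)) ≤ τ) :
    utility (robustMechanism M O δ τ c) (w i) i t b =
      ∫ y, discountedUtility M (w i) c i t y ∂(averaged (profileSampler O δ) b) := by
  rw [utility_robustMechanism]
  simp only [robustOutput, hi, if_true]
  exact integral_bind_kernel (((hw i).integrable_bundle t i _).sub
    (integrable_discounted_payment_of_ae_le c
      (ae_queried_payment_le O hδ hM hw hG hIR b i)))

/-- The robust mechanism is individually rational for all types. -/
theorem isIR_robustMechanism (O : LatentOracle G) {δ : ℝ} (hδ : 0 < δ) (τ : ℝ) {c : ℝ≥0}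
    (hM : HasPaymentRule M) (hw : ∀ i, IsRegularValuation H (w i))
    (hG : ∀ i, ∀ a ∈ (G i).support, ∀ j, |a j| ≤ 1)
    (hIR : IsIR M w fun i => (G i).support) (hc : H * (τ + δ) ≤ c) :
    IsIR (robustMechanism M O δ τ c) w fun _ => Set.univ := by
  intro b _ i
  constructor
  · refine integrable_payment_of_ae_le (B := H) ?_
    rw [robustMechanism_apply, ae_map_iff (measurable_robustOutput_right _ _ _ _).aemeasurable
      (measurableSet_le (by fun_prop) measurable_const)]
    filter_upwards [ae_queried_payment_le O hδ hM hw hG hIR b i] with o ho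
    by_cases hi : dist (b i) (O.nearest i (b i)) ≤ τ
    · simp only [robustOutput, hi, if_true]
      exact (NNReal.coe_le_coe.2 tsub_le_self).trans ho
    · simp only [robustOutput, hi, if_false]
      exact le_trans (by simp) ho
  · by_cases hi : dist (b i) (O.nearest i (b i)) ≤ τ
    · rw [utility_robustMechanism_of_le O hδ τ c hM hw hG hIR _ hi]
      refine integral_nonneg_of_ae ?_
      filter_upwards [ae_averaged_profileSampler_mem O hδ b] with y hy
      -- The report is within `τ` of its rounding, and the rounding is within `δ` of the sample in
      -- each coordinate.
      refine discountedUtility_nonneg hM (hw i) (hIR y (fun i => (hy i).1) i).2 (D := τ + δ)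
        (fun j => ?_) hc
      rw [abs_sub_comm]
      refine (abs_sub_le (b i j) (O.nearest i (b i) j) (y i j)).trans ?_
      exact add_le_add ((abs_sub_apply_le_dist _ _ j).trans hi) ((hy i).2 j).le
    · rw [utility_robustMechanism_of_not_le O δ τ c (hw i) _ hi]

variable [∀ i, IsProbabilityMeasure (G i)]

/-- The mean of a bounded function of the resampled profile, for true types drawn from `F`
except for the report `r` of bidder `i`. -/
theorem abs_integral_update_sub_le (O : LatentOracle G) {δ : ℝ} (hδ : 0 < δ)
    {F : Fin n → Measure (Latent p k)} [∀ i, IsProbabilityMeasure (F i)] {ζ : ℝ}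
    (hζ : ∀ i, levyProkhorovDist (F i) (G i) ≤ ζ) {f : (Fin n → Latent p k) → ℝ}
    (hf : Measurable f) {B : ℝ} (hB : ∀ y, |f y| ≤ B) (i : Fin n) (r : Latent p k) :
    |∫ s, ∫ y, f y ∂(averaged (profileSampler O δ) (Function.update s i r)) ∂(Measure.pi F) -
      ∫ a, ∫ s, f (Function.update s i a) ∂(Measure.pi G) ∂(averaged (cellSampler O δ i) r)| ≤
      n * (8 * B * (1 + (k : ℝ) ^ (1 - 1 / p.toReal) / δ) * ζ) := by
  have hφm := measurable_integral_kernel (averaged (profileSampler O δ)) hf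
  have hφB : ∀ z, |∫ y, f y ∂(averaged (profileSampler O δ) z)| ≤ B := fun z =>
    abs_integral_le_of_bounded (ae_of_all _ hB)
  have hF := isProbabilityMeasure_update F i (Measure.dirac r)
  have hG := isProbabilityMeasure_update G i (Measure.dirac r)
  have hG' := isProbabilityMeasure_update G i (averaged (cellSampler O δ i) r)
  have hfi : ∀ (μ : Measure (Fin n → Latent p k)) [IsFiniteMeasure μ], Integrable f μ :=
    fun μ _ => integrable_of_measurable_of_bounded hf hB
  have hB0 : 0 ≤ B := (abs_nonneg _).trans (hB fun _ => 0)
  have hζ0 : 0 ≤ ζ := ENNReal.toReal_nonneg.trans (hζ i)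
  -- Only the opponents' factors are exchanged; the factor of bidder `i` is the same Dirac mass on
  -- both sides.
  have key := abs_integral_pi_sub_le (Function.update F i (Measure.dirac r))
    (Function.update G i (Measure.dirac r)) hφm hφB
    (e := 8 * B * (1 + (k : ℝ) ^ (1 - 1 / p.toReal) / δ) * ζ) fun j z => by
      by_cases hj : j = i
      · subst hj
        simp only [Function.update_self, sub_self, abs_zero]
        positivity
      · rw [Function.update_of_ne hj, Function.update_of_ne hj]
        exact abs_integral_averaged_update_sub_le' O hδ hf hB z j (hζ j)
  rw [integral_pi_update_dirac F i r hφm, Fintype.card_fin] at key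
  have h2 : ∫ z, ∫ y, f y ∂(averaged (profileSampler O δ) z)
      ∂(Measure.pi (Function.update G i (Measure.dirac r))) =
      ∫ a, ∫ s, f (Function.update s i a) ∂(Measure.pi G) ∂(averaged (cellSampler O δ i) r) := by
    rw [← integral_pi_update G i _ hf (hfi _), ← bind_averaged_profileSampler_update_eq O hδ,
      integral_bind_kernel (hfi _)]
  rwa [h2] at key

end Robust

/-! ### Types far from the support. -/

section FarTypes

variable {n k : ℕ} {p : ℝ≥0∞} [Fact (1 ≤ p)] {G : Fin n → Measure (Latent p k)}

theorem LatentOracle.measurableSet_dist_nearest_le (O : LatentOracle G) (i : Fin n) (τ : ℝ) :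
    MeasurableSet {a : Latent p k | dist a (O.nearest i a) ≤ τ} := by
  have := O.nearest_measurable i
  exact measurableSet_le (by fun_prop) measurable_const

variable [∀ i, IsProbabilityMeasure (G i)]

/-- Few types are far from the support of a nearby distribution. -/
theorem measure_far_le (O : LatentOracle G) (i : Fin n) {F : Measure (Latent p k)}
    [IsProbabilityMeasure F] {τ : ℝ} (hτ : levyProkhorovDist F (G i) < τ) :
    F {a | ¬ dist a (O.nearest i a) ≤ τ} ≤ ENNReal.ofReal τ := by
  have hτ0 : 0 ≤ τ := ENNReal.toReal_nonneg.trans hτ.le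
  have hE : levyProkhorovEDist F (G i) < ENNReal.ofReal τ :=
    (ENNReal.lt_ofReal_iff_toReal_lt (levyProkhorovEDist_ne_top F (G i))).2 hτ
  -- The support has full `G i`-mass, so its `τ`-thickening has `F`-mass at least `1 - τ`.
  have h1 := right_measure_le_of_levyProkhorovEDist_lt hE
    (Measure.isClosed_support (μ := G i)).measurableSet
  rw [ENNReal.toReal_ofReal hτ0,
    (mem_ae_iff_prob_eq_one
      (Measure.isClosed_support (μ := G i)).measurableSet).1
        (Measure.support_mem_ae (μ := G i))] at h1
  have h2 : F (Metric.thickening τ (G i).support) ≤ F {a | dist a (O.nearest i a) ≤ τ} := by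
    refine measure_mono fun a ha => ?_
    obtain ⟨b, hb, hab⟩ := Metric.mem_thickening_iff.1 ha
    exact (O.nearest_le i a b hb).trans hab.le
  change F {a | dist a (O.nearest i a) ≤ τ}ᶜ ≤ _
  rw [prob_compl_eq_one_sub (O.measurableSet_dist_nearest_le i τ), tsub_le_iff_left]
  exact h1.trans (by gcongr)

end FarTypes

/-! ### Incentive compatibility near the support. -/

section Incentives

variable {n m k : ℕ} {p : ℝ≥0∞} {G : Fin n → Measure (Latent p k)}

/-- The discounted payoff, cut off outside the profiles of support points. -/
def cutUtility (G : Fin n → Measure (Latent p k)) (M : Mechanism n m (Latent p k))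
    (w : Latent p k → Set (Fin m) → ℝ≥0) (c : ℝ≥0) (i : Fin n) (t : Latent p k) :
    (Fin n → Latent p k) → ℝ :=
  Set.indicator {y | ∀ i, y i ∈ (G i).support} (discountedUtility M w c i t)

/-- The interim payoff at the sampled entry `a`, with the other entries drawn from `G`. -/
def cutInterim (G : Fin n → Measure (Latent p k)) (M : Mechanism n m (Latent p k))
    (w : Latent p k → Set (Fin m) → ℝ≥0) (c : ℝ≥0) (i : Fin n) (t a : Latent p k) : ℝ :=
  ∫ s, cutUtility G M w c i t (Function.update s i a) ∂(Measure.pi G)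

theorem update_mem_support {i : Fin n} {s : Fin n → Latent p k} {a : Latent p k}
    (hs : ∀ i, s i ∈ (G i).support) (ha : a ∈ (G i).support) (j : Fin n) :
    Function.update s i a j ∈ (G j).support := by
  by_cases h : j = i
  · subst h; simpa
  · simpa [h] using hs j

variable {M : Mechanism n m (Latent p k)} [IsMarkovKernel M]

theorem measurable_cutUtility (w : Latent p k → Set (Fin m) → ℝ≥0) (c : ℝ≥0) (i : Fin n)
    (t : Latent p k) : Measurable (cutUtility G M w c i t) :=
  (measurable_discountedUtility M w c i t).indicator measurableSet_pi_support

variable [Fact (1 ≤ p)] {H : ℝ} {w : Fin n → Latent p k → Set (Fin m) → ℝ≥0}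

/-- IR is available only on profiles of support points, and elsewhere payments may be unbounded. The
cutoff yields a function bounded everywhere, as the transfer estimates require, and resampled
profiles almost surely do not see it. -/
theorem abs_cutUtility_le (hM : HasPaymentRule M) (hw : ∀ i, IsRegularValuation H (w i))
    (hG : ∀ i, ∀ a ∈ (G i).support, ∀ j, |a j| ≤ 1)
    (hIR : IsIR M w fun i => (G i).support) (c : ℝ≥0) (i : Fin n) {t : Latent p k} {D : ℝ}
    (ht : ∀ j, |t j| ≤ D) {B : ℝ} (hB0 : 0 ≤ B) (hHB : H ≤ B) (hB : H * D ≤ B)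
    (y : Fin n → Latent p k) : |cutUtility G M (w i) c i t y| ≤ B := by
  by_cases hy : ∀ i, y i ∈ (G i).support
  · rw [cutUtility, Set.indicator_of_mem (show y ∈ {y | ∀ i, y i ∈ (G i).support} from hy)]
    exact abs_discountedUtility_le hM (hw i) (hIR y hy i).2 (hG i _ (hy i)) c ht hHB hB
  · rw [cutUtility, Set.indicator_of_notMem
      (show y ∉ {y | ∀ i, y i ∈ (G i).support} from hy)]
    simpa using hB0

variable [∀ i, IsProbabilityMeasure (G i)]

theorem integrable_utility_update (hM : HasPaymentRule M)
    (hw : ∀ i, IsRegularValuation H (w i))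
    (hG : ∀ i, ∀ a ∈ (G i).support, ∀ j, |a j| ≤ 1)
    (hIR : IsIR M w fun i => (G i).support) {i : Fin n} (t : Latent p k)
    {a : Latent p k} (ha : a ∈ (G i).support) :
    Integrable (fun s => utility M (w i) i t (Function.update s i a)) (Measure.pi G) := by
  have hm : Measurable fun s : Fin n → Latent p k => Function.update s i a := by fun_prop
  refine Integrable.of_bound (C := max H (H * ‖t‖))
    ((measurable_utility M (w i) i t).comp hm).aestronglyMeasurable ?_
  filter_upwards [ae_pi_mem_support (G := G)] with s hs
  have hy := update_mem_support hs ha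
  exact abs_utility_le hM (hw i) (hIR _ hy i).2 (hG i _ (hy i))
    (fun j => PiLp.norm_apply_le t j) (le_max_left _ _) (le_max_right _ _)

theorem integrable_cutUtility_update (hM : HasPaymentRule M)
    (hw : ∀ i, IsRegularValuation H (w i))
    (hG : ∀ i, ∀ a ∈ (G i).support, ∀ j, |a j| ≤ 1)
    (hIR : IsIR M w fun i => (G i).support) (c : ℝ≥0) (i : Fin n) (t a : Latent p k) :
    Integrable (fun s => cutUtility G M (w i) c i t (Function.update s i a)) (Measure.pi G) := by
  have hm : Measurable fun s : Fin n → Latent p k => Function.update s i a := by fun_prop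
  refine integrable_of_measurable_of_bounded (B := max 0 (max H (H * ‖t‖)))
    ((measurable_cutUtility (w i) c i t).comp hm) fun s => ?_
  exact abs_cutUtility_le hM hw hG hIR c i (fun j => PiLp.norm_apply_le t j) (le_max_left _ _)
    ((le_max_left _ _).trans (le_max_right _ _)) ((le_max_right _ _).trans (le_max_right _ _)) _

theorem interimUtility_le_cutInterim (hM : HasPaymentRule M)
    (hw : ∀ i, IsRegularValuation H (w i))
    (hG : ∀ i, ∀ a ∈ (G i).support, ∀ j, |a j| ≤ 1)
    (hIR : IsIR M w fun i => (G i).support) (c : ℝ≥0) {i : Fin n} (t : Latent p k)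
    {a : Latent p k} (ha : a ∈ (G i).support) :
    interimUtility M w G i t a ≤ cutInterim G M (w i) c i t a := by
  refine integral_mono_ae (integrable_utility_update hM hw hG hIR t ha)
    (integrable_cutUtility_update hM hw hG hIR c i t a) ?_
  filter_upwards [ae_pi_mem_support (G := G)] with s hs
  rw [cutUtility, Set.indicator_of_mem (show _ ∈ {y : Fin n → Latent p k |
    ∀ i, y i ∈ (G i).support} from update_mem_support hs ha)]
  exact utility_le_discountedUtility hM (hw i) c i t _

theorem cutInterim_le_interimUtility_add (hM : HasPaymentRule M)
    (hw : ∀ i, IsRegularValuation H (w i))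
    (hG : ∀ i, ∀ a ∈ (G i).support, ∀ j, |a j| ≤ 1)
    (hIR : IsIR M w fun i => (G i).support) (c : ℝ≥0) {i : Fin n} (t : Latent p k)
    {a : Latent p k} (ha : a ∈ (G i).support) :
    cutInterim G M (w i) c i t a ≤ interimUtility M w G i t a + c := by
  refine integral_le_integral_add_of_ae (integrable_cutUtility_update hM hw hG hIR c i t a)
    (integrable_utility_update hM hw hG hIR t ha) ?_
  filter_upwards [ae_pi_mem_support (G := G)] with s hs
  rw [cutUtility, Set.indicator_of_mem (show _ ∈ {y : Fin n → Latent p k |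
    ∀ i, y i ∈ (G i).support} from update_mem_support hs ha)]
  exact discountedUtility_le_utility_add hM (hw i) c i t _

theorem interimUtility_le_add (hM : HasPaymentRule M)
    (hw : ∀ i, IsRegularValuation H (w i))
    (hG : ∀ i, ∀ a ∈ (G i).support, ∀ j, |a j| ≤ 1)
    (hIR : IsIR M w fun i => (G i).support) {i : Fin n} {t t' : Latent p k} {D : ℝ}
    (h : ∀ j, |t j - t' j| ≤ D) {a : Latent p k} (ha : a ∈ (G i).support) :
    interimUtility M w G i t a ≤ interimUtility M w G i t' a + H * D :=
  integral_le_integral_add_of_ae (integrable_utility_update hM hw hG hIR t ha)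
    (integrable_utility_update hM hw hG hIR t' ha)
    (ae_of_all _ fun _ => utility_le_utility_add hM (hw i) h i _)

/-- Reporting any support point is at most `3c` better than reporting a point near the type. -/
theorem cutInterim_le_cutInterim_add (hM : HasPaymentRule M)
    (hw : ∀ i, IsRegularValuation H (w i))
    (hG : ∀ i, ∀ a ∈ (G i).support, ∀ j, |a j| ≤ 1)
    (hIR : IsIR M w fun i => (G i).support) (hBIC : IsBIC M w G) {c : ℝ≥0} {D : ℝ}
    (hc : H * D ≤ c) {i : Fin n} {t a a' : Latent p k} (ha : a ∈ (G i).support)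
    (ha' : a' ∈ (G i).support) (h : ∀ j, |t j - a' j| ≤ D) :
    cutInterim G M (w i) c i t a ≤ cutInterim G M (w i) c i t a' + 3 * c := by
  -- One `c` is the discount at `a`. The other two pay for `H * D` twice, when the type moves from
  -- `t` to `a'`, where exact BIC applies, and back.
  have h1 := cutInterim_le_interimUtility_add hM hw hG hIR c t ha
  have h2 := interimUtility_le_add hM hw hG hIR h ha
  have h3 := hBIC i a' ha' a ha
  have h4 := interimUtility_le_add hM hw hG hIR (t := a') (t' := t)
    (fun j => by rw [abs_sub_comm]; exact h j) ha'
  have h5 := interimUtility_le_cutInterim hM hw hG hIR c t ha'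
  linarith

theorem integrable_cutInterim (hM : HasPaymentRule M)
    (hw : ∀ i, IsRegularValuation H (w i))
    (hG : ∀ i, ∀ a ∈ (G i).support, ∀ j, |a j| ≤ 1)
    (hIR : IsIR M w fun i => (G i).support) (c : ℝ≥0) (i : Fin n) (t : Latent p k)
    (μ : Measure (Latent p k)) [IsProbabilityMeasure μ] :
    Integrable (cutInterim G M (w i) c i t) μ := by
  have hm : Measurable (Function.uncurry fun (a : Latent p k) (s : Fin n → Latent p k) =>
      cutUtility G M (w i) c i t (Function.update s i a)) :=
    (measurable_cutUtility (w i) c i t).comp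
      (show Measurable fun q : Latent p k × (Fin n → Latent p k) => Function.update q.2 i q.1
        by fun_prop)
  refine Integrable.of_bound (C := max 0 (max H (H * ‖t‖)))
    (hm.stronglyMeasurable.integral_prod_right (ν := Measure.pi G)).aestronglyMeasurable
    (ae_of_all _ fun a => abs_integral_le_of_bounded (ae_of_all _ fun s => ?_))
  exact abs_cutUtility_le hM hw hG hIR c i (fun j => PiLp.norm_apply_le t j) (le_max_left _ _)
    ((le_max_left _ _).trans (le_max_right _ _)) ((le_max_right _ _).trans (le_max_right _ _)) _

/-- Replacing the opponents' distributions `F` by `G` costs one transfer error each. After that,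
resampling leaves the opponents distributed as `G` and turns the report `r` into an independent
sample near its rounding. -/
theorem abs_interimUtility_robustMechanism_sub_le (O : LatentOracle G) {δ : ℝ} (hδ : 0 < δ)
    (τ : ℝ) (c : ℝ≥0) (hM : HasPaymentRule M) (hw : ∀ i, IsRegularValuation H (w i))
    (hG : ∀ i, ∀ a ∈ (G i).support, ∀ j, |a j| ≤ 1)
    (hIR : IsIR M w fun i => (G i).support)
    {F : Fin n → Measure (Latent p k)} [∀ i, IsProbabilityMeasure (F i)] {ζ : ℝ}
    (hζ : ∀ i, levyProkhorovDist (F i) (G i) ≤ ζ) {i : Fin n} {t r : Latent p k} {D : ℝ}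
    (ht : ∀ j, |t j| ≤ D) {B : ℝ} (hB0 : 0 ≤ B) (hHB : H ≤ B) (hB : H * D ≤ B)
    (hr : dist r (O.nearest i r) ≤ τ) :
    |interimUtility (robustMechanism M O δ τ c) w F i t r -
      ∫ a, cutInterim G M (w i) c i t a ∂(averaged (cellSampler O δ i) r)| ≤
      n * (8 * B * (1 + (k : ℝ) ^ (1 - 1 / p.toReal) / δ) * ζ) := by
  have h := abs_integral_update_sub_le O hδ hζ (measurable_cutUtility (G := G) (M := M) (w i) c i t)
    (abs_cutUtility_le hM hw hG hIR c i ht hB0 hHB hB) i r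
  suffices heq : interimUtility (robustMechanism M O δ τ c) w F i t r =
      ∫ s, ∫ y, cutUtility G M (w i) c i t y
        ∂(averaged (profileSampler O δ) (Function.update s i r)) ∂(Measure.pi F) by
    rw [heq]; exact h
  refine integral_congr_ae (ae_of_all _ fun s => ?_)
  change utility _ _ _ _ _ = _
  rw [utility_robustMechanism_of_le O hδ τ c hM hw hG hIR t (by simpa using hr)]
  refine integral_congr_ae ?_
  filter_upwards [ae_averaged_profileSampler_mem O hδ (Function.update s i r)] with y hy
  rw [cutUtility, Set.indicator_of_mem
    (show y ∈ {y : Fin n → Latent p k | ∀ i, y i ∈ (G i).support} from fun i => (hy i).1)]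

/-- Types near the support gain little from any misreport to the robust mechanism. -/
theorem interimUtility_robustMechanism_le (O : LatentOracle G) {δ : ℝ} (hδ : 0 < δ)
    {τ : ℝ} {c : ℝ≥0} (hM : HasPaymentRule M) (hw : ∀ i, IsRegularValuation H (w i))
    (hG : ∀ i, ∀ a ∈ (G i).support, ∀ j, |a j| ≤ 1)
    (hIR : IsIR M w fun i => (G i).support) (hBIC : IsBIC M w G) (hc : H * (τ + δ) ≤ c)
    {F : Fin n → Measure (Latent p k)} [∀ i, IsProbabilityMeasure (F i)] {ζ : ℝ}
    (hζ : ∀ i, levyProkhorovDist (F i) (G i) ≤ ζ) {i : Fin n} {t : Latent p k} {D : ℝ}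
    (hD : ∀ j, |t j| ≤ D) {B : ℝ} (hB0 : 0 ≤ B) (hHB : H ≤ B) (hB : H * D ≤ B)
    (ht : dist t (O.nearest i t) ≤ τ) (r : Latent p k) :
    interimUtility (robustMechanism M O δ τ c) w F i t r ≤
      interimUtility (robustMechanism M O δ τ c) w F i t t +
        (3 * c + 2 * (n * (8 * B * (1 + (k : ℝ) ^ (1 - 1 / p.toReal) / δ) * ζ))) := by
  have hζ0 : 0 ≤ ζ := ENNReal.toReal_nonneg.trans (hζ i)
  by_cases hr : dist r (O.nearest i r) ≤ τ
  · have h1 := (abs_le.1 (abs_interimUtility_robustMechanism_sub_le O hδ τ c hM hw hG hIR hζ hD hB0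
      hHB hB hr)).2
    have h2 := (abs_le.1 (abs_interimUtility_robustMechanism_sub_le O hδ τ c hM hw hG hIR hζ hD hB0
      hHB hB ht)).1
    have h3 := integral_le_integral_add_of_ae_ae (c := 3 * (c : ℝ))
      (integrable_cutInterim hM hw hG hIR c i t (averaged (cellSampler O δ i) r))
      (integrable_cutInterim hM hw hG hIR c i t (averaged (cellSampler O δ i) t))
      (ae_averaged_cellSampler_mem O hδ i r) (ae_averaged_cellSampler_mem O hδ i t)
      fun a a' ha ha' => cutInterim_le_cutInterim_add hM hw hG hIR hBIC (D := τ + δ) hc ha.1 ha'.1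
        fun j => (abs_sub_le (t j) (O.nearest i t j) (a' j)).trans
          (add_le_add ((abs_sub_apply_le_dist _ _ j).trans ht) (ha'.2 j).le)
    linarith
  -- A far misreport is dropped and earns zero, whereas truth-telling earns at least zero by IR.
  · have h1 : interimUtility (robustMechanism M O δ τ c) w F i t r = 0 := by
      rw [interimUtility]
      refine integral_eq_zero_of_ae (ae_of_all _ fun s => ?_)
      exact utility_robustMechanism_of_not_le O δ τ c (hw i) t (by simpa using hr)
    have h2 : 0 ≤ interimUtility (robustMechanism M O δ τ c) w F i t t := by
      refine integral_nonneg fun s => ?_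
      have := (isIR_robustMechanism O hδ τ hM hw hG hIR hc (Function.update s i t)
        (fun _ => trivial) i).2
      simpa using this
    rw [h1]
    have : 0 ≤ 8 * B * (1 + (k : ℝ) ^ (1 - 1 / p.toReal) / δ) * ζ := by positivity
    positivity

end Incentives

/-! ### Revenue. -/

section Revenue

theorem revenue_eq_sum {n m : ℕ} {Θ : Type} [MeasurableSpace Θ] (M : Mechanism n m Θ)
    (F : Fin n → Measure Θ) :
    revenue M F = ∑ i, ∫⁻ b, ∫⁻ o, (o.2 i : ℝ≥0∞) ∂(M b) ∂(Measure.pi F) := by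
  have hm : ∀ i : Fin n, Measurable fun o : Outcome n m => (o.2 i : ℝ≥0∞) := fun i => by fun_prop
  rw [revenue]
  simp_rw [ENNReal.ofNNReal_finsetSum]
  rw [lintegral_finsetSum _ fun i _ => hm i]
  exact Finset.sum_congr rfl fun i _ =>
    Measure.lintegral_bind M.aemeasurable (hm i).aemeasurable

variable {n m k : ℕ} {p : ℝ≥0∞} {G : Fin n → Measure (Latent p k)}
  {M : Mechanism n m (Latent p k)} {H : ℝ} {w : Fin n → Latent p k → Set (Fin m) → ℝ≥0}

/-- The expected payment of bidder `i`, cut off outside the profiles of support points. -/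
def cutPayment (G : Fin n → Measure (Latent p k)) (M : Mechanism n m (Latent p k)) (i : Fin n) :
    (Fin n → Latent p k) → ℝ :=
  Set.indicator {y | ∀ i, y i ∈ (G i).support} fun y => ∫ o, (o.2 i : ℝ) ∂(M y)

theorem cutPayment_nonneg (i : Fin n) (y : Fin n → Latent p k) : 0 ≤ cutPayment G M i y :=
  Set.indicator_nonneg (fun _ _ => integral_nonneg fun _ => NNReal.coe_nonneg _) _

theorem lintegral_payment_eq (hIR : IsIR M w fun i => (G i).support) (i : Fin n)
    {y : Fin n → Latent p k} (hy : ∀ i, y i ∈ (G i).support) :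
    ∫⁻ o, (o.2 i : ℝ≥0∞) ∂(M y) = ENNReal.ofReal (cutPayment G M i y) := by
  rw [cutPayment, Set.indicator_of_mem (show y ∈ {y | ∀ i, y i ∈ (G i).support} from hy),
    ofReal_integral_eq_lintegral_ofReal (hIR y hy i).1 (ae_of_all _ fun _ => NNReal.coe_nonneg _)]
  simp

variable [IsMarkovKernel M]

theorem measurable_cutPayment (i : Fin n) : Measurable (cutPayment G M i) :=
  (measurable_integral_kernel M (by fun_prop)).indicator measurableSet_pi_support

variable [Fact (1 ≤ p)]

theorem abs_cutPayment_le (hM : HasPaymentRule M) (hw : ∀ i, IsRegularValuation H (w i))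
    (hG : ∀ i, ∀ a ∈ (G i).support, ∀ j, |a j| ≤ 1)
    (hIR : IsIR M w fun i => (G i).support) (hH : 0 ≤ H) (i : Fin n) (y : Fin n → Latent p k) :
    |cutPayment G M i y| ≤ H := by
  by_cases hy : ∀ i, y i ∈ (G i).support
  · rw [cutPayment, Set.indicator_of_mem (show y ∈ {y | ∀ i, y i ∈ (G i).support} from hy)]
    refine abs_integral_le_of_bounded ?_
    filter_upwards [ae_payment_le hM (hw i) (hIR y hy i).2 (hG i _ (hy i))] with o ho
    rwa [abs_of_nonneg (NNReal.coe_nonneg _)]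
  · rw [cutPayment, Set.indicator_of_notMem (show y ∉ {y | ∀ i, y i ∈ (G i).support} from hy)]
    simpa using hH

/-- The expected payment of a bidder in the robust mechanism: the discount and the exclusion of
far reports are the only losses. -/
theorem ofReal_integral_cutPayment_le (O : LatentOracle G) {δ : ℝ} (hδ : 0 < δ) (τ : ℝ) (c : ℝ≥0)
    (hM : HasPaymentRule M) (hw : ∀ i, IsRegularValuation H (w i))
    (hG : ∀ i, ∀ a ∈ (G i).support, ∀ j, |a j| ≤ 1)
    (hIR : IsIR M w fun i => (G i).support) (hH : 0 ≤ H) (i : Fin n) (b : Fin n → Latent p k) :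
    ENNReal.ofReal (∫ y, cutPayment G M i y ∂(averaged (profileSampler O δ) b)) ≤
      ∫⁻ o, (o.2 i : ℝ≥0∞) ∂(robustMechanism M O δ τ c b) + c +
        {b : Fin n → Latent p k | ¬ dist (b i) (O.nearest i (b i)) ≤ τ}.indicator
          (fun _ => ENNReal.ofReal H) b := by
  by_cases hb : dist (b i) (O.nearest i (b i)) ≤ τ
  · refine le_add_right ?_
    have hm : Measurable fun o : Outcome n m => (o.2 i : ℝ≥0∞) := by fun_prop
    rw [ofReal_integral_eq_lintegral_ofReal
      (integrable_of_measurable_of_bounded (measurable_cutPayment i)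
        (abs_cutPayment_le hM hw hG hIR hH i)) (ae_of_all _ (cutPayment_nonneg i)),
      robustMechanism_apply, lintegral_map hm (measurable_robustOutput_right _ _ _ _)]
    have h1 : ∫⁻ y, ENNReal.ofReal (cutPayment G M i y) ∂(averaged (profileSampler O δ) b) =
        ∫⁻ o, (o.2 i : ℝ≥0∞) ∂((averaged (profileSampler O δ) b).bind M) := by
      rw [Measure.lintegral_bind M.aemeasurable hm.aemeasurable]
      refine lintegral_congr_ae ?_
      filter_upwards [ae_averaged_profileSampler_mem O hδ b] with y hy
      exact (lintegral_payment_eq hIR i fun i => (hy i).1).symm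
    rw [h1]
    simp only [robustOutput, hb, if_true]
    -- The truncated subtraction loses at most `c`.
    calc _ ≤ ∫⁻ o : Outcome n m, (((o.2 i - c : ℝ≥0) : ℝ≥0∞) + c)
          ∂((averaged (profileSampler O δ) b).bind M) :=
        lintegral_mono fun o => by
          rw [← ENNReal.coe_add]; exact ENNReal.coe_le_coe.2 le_tsub_add
      _ = _ := by rw [lintegral_add_right _ measurable_const]; simp
  · refine le_add_left ?_
    rw [Set.indicator_of_mem (show b ∈ {b : Fin n → Latent p k |
      ¬ dist (b i) (O.nearest i (b i)) ≤ τ} from hb)]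
    exact ENNReal.ofReal_le_ofReal ((le_abs_self _).trans
      (abs_integral_le_of_bounded (ae_of_all _ (abs_cutPayment_le hM hw hG hIR hH i))))

variable [∀ i, IsProbabilityMeasure (G i)]

/-- There are three losses: the transfer from `G` to `F` over all bidders, the discount `c`, and
payments of at most `H` on the event, of probability at most `τ`, that bidder `i` is dropped. -/
theorem lintegral_payment_le (O : LatentOracle G) {δ : ℝ} (hδ : 0 < δ) {τ : ℝ} (c : ℝ≥0)
    (hM : HasPaymentRule M) (hw : ∀ i, IsRegularValuation H (w i))
    (hG : ∀ i, ∀ a ∈ (G i).support, ∀ j, |a j| ≤ 1)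
    (hIR : IsIR M w fun i => (G i).support) (hH : 0 ≤ H)
    {F : Fin n → Measure (Latent p k)} [∀ i, IsProbabilityMeasure (F i)] {ζ : ℝ}
    (hζ : ∀ i, levyProkhorovDist (F i) (G i) ≤ ζ) (hτ : ζ < τ) (i : Fin n) :
    ∫⁻ b, ∫⁻ o, (o.2 i : ℝ≥0∞) ∂(M b) ∂(Measure.pi G) ≤
      ∫⁻ b, ∫⁻ o, (o.2 i : ℝ≥0∞) ∂(robustMechanism M O δ τ c b) ∂(Measure.pi F) +
        ENNReal.ofReal (n * (8 * H * (1 + (k : ℝ) ^ (1 - 1 / p.toReal) / δ) * ζ) + c + H * τ) := by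
  have hζ0 : 0 ≤ ζ := ENNReal.toReal_nonneg.trans (hζ i)
  have hf := measurable_cutPayment (G := G) (M := M) i
  have hB := abs_cutPayment_le hM hw hG hIR hH i
  have hfi : ∀ (μ : Measure (Fin n → Latent p k)) [IsFiniteMeasure μ],
      Integrable (cutPayment G M i) μ := fun μ _ => integrable_of_measurable_of_bounded hf hB
  set e : ℝ := n * (8 * H * (1 + (k : ℝ) ^ (1 - 1 / p.toReal) / δ) * ζ) with he
  have he0 : 0 ≤ e := by positivity
  set φ : (Fin n → Latent p k) → ℝ :=
    fun z => ∫ y, cutPayment G M i y ∂(averaged (profileSampler O δ) z) with hφ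
  have hφm : Measurable φ := measurable_integral_kernel (averaged (profileSampler O δ)) hf
  have hφB : ∀ z, |φ z| ≤ H := fun z => abs_integral_le_of_bounded (ae_of_all _ hB)
  have hφ0 : ∀ z, 0 ≤ φ z := fun z => integral_nonneg (cutPayment_nonneg i)
  have h1 : ∫⁻ b, ∫⁻ o, (o.2 i : ℝ≥0∞) ∂(M b) ∂(Measure.pi G) =
      ENNReal.ofReal (∫ y, cutPayment G M i y ∂(Measure.pi G)) := by
    rw [ofReal_integral_eq_lintegral_ofReal (hfi _) (ae_of_all _ (cutPayment_nonneg i))]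
    refine lintegral_congr_ae ?_
    filter_upwards [ae_pi_mem_support (G := G)] with y hy
    exact lintegral_payment_eq hIR i hy
  -- Under `G` itself resampling changes nothing, so the comparison can be made between smoothed
  -- payments.
  have h2 : ∫ y, cutPayment G M i y ∂(Measure.pi G) = ∫ z, φ z ∂(Measure.pi G) := by
    conv_lhs => rw [← bind_averaged_profileSampler_eq O hδ]
    exact integral_bind_kernel (hfi _)
  have h3 : ∫ z, φ z ∂(Measure.pi G) ≤ ∫ z, φ z ∂(Measure.pi F) + e := by
    have := (abs_le.1 (abs_integral_pi_sub_le F G hφm hφB fun j z =>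
      abs_integral_averaged_update_sub_le' O hδ hf hB z j (hζ j))).1
    rw [Fintype.card_fin] at this
    linarith
  have hms : MeasurableSet {a : Latent p k | ¬ dist a (O.nearest i a) ≤ τ} :=
    (O.measurableSet_dist_nearest_le i τ).compl
  have hfar : MeasurableSet {b : Fin n → Latent p k | ¬ dist (b i) (O.nearest i (b i)) ≤ τ} :=
    (measurable_pi_apply (X := fun _ : Fin n => Latent p k) i) hms
  have hfarF : Measure.pi F {b : Fin n → Latent p k | ¬ dist (b i) (O.nearest i (b i)) ≤ τ} ≤
      ENNReal.ofReal τ :=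
    ((measurePreserving_eval F i).measure_preimage hms.nullMeasurableSet).trans_le
      (measure_far_le O i ((hζ i).trans_lt hτ))
  have h4 : ENNReal.ofReal (∫ z, φ z ∂(Measure.pi F)) ≤
      ∫⁻ b, ∫⁻ o, (o.2 i : ℝ≥0∞) ∂(robustMechanism M O δ τ c b) ∂(Measure.pi F) + c +
        ENNReal.ofReal (H * τ) := by
    rw [ofReal_integral_eq_lintegral_ofReal (integrable_of_measurable_of_bounded hφm hφB)
      (ae_of_all _ hφ0)]
    refine (lintegral_mono fun b =>
      ofReal_integral_cutPayment_le O hδ τ c hM hw hG hIR hH i b).trans ?_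
    rw [lintegral_add_right _ (measurable_const.indicator hfar),
      lintegral_add_right _ measurable_const, lintegral_indicator_const hfar,
      ENNReal.ofReal_mul hH]
    simp only [lintegral_const, measure_univ, mul_one]
    gcongr
  rw [h1, h2]
  calc _ ≤ ENNReal.ofReal (∫ z, φ z ∂(Measure.pi F) + e) := ENNReal.ofReal_le_ofReal h3
    _ = ENNReal.ofReal (∫ z, φ z ∂(Measure.pi F)) + ENNReal.ofReal e :=
      ENNReal.ofReal_add (integral_nonneg hφ0) he0
    _ ≤ _ := by
      have hτ0 : 0 ≤ τ := hζ0.trans hτ.le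
      rw [ENNReal.ofReal_add (by positivity) (by positivity),
        ENNReal.ofReal_add he0 (by positivity), ENNReal.ofReal_coe_nnreal]
      refine (add_le_add_left h4 _).trans_eq ?_
      ring

theorem revenue_le_revenue_robustMechanism_add (O : LatentOracle G) {δ : ℝ} (hδ : 0 < δ) {τ : ℝ}
    (c : ℝ≥0) (hM : HasPaymentRule M) (hw : ∀ i, IsRegularValuation H (w i))
    (hG : ∀ i, ∀ a ∈ (G i).support, ∀ j, |a j| ≤ 1)
    (hIR : IsIR M w fun i => (G i).support) (hH : 0 ≤ H)
    {F : Fin n → Measure (Latent p k)} [∀ i, IsProbabilityMeasure (F i)] {ζ : ℝ}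
    (hζ : ∀ i, levyProkhorovDist (F i) (G i) ≤ ζ) (hτ : ζ < τ) {η : ℝ}
    (hη : n ≠ 0 →
      n * (8 * H * (1 + (k : ℝ) ^ (1 - 1 / p.toReal) / δ) * ζ) + c + H * τ ≤ η) :
    revenue M G ≤ revenue (robustMechanism M O δ τ c) F + ENNReal.ofReal (n * η) := by
  rw [revenue_eq_sum, revenue_eq_sum]
  have h : ∀ i : Fin n, ∫⁻ b, ∫⁻ o, (o.2 i : ℝ≥0∞) ∂(M b) ∂(Measure.pi G) ≤
      ∫⁻ b, ∫⁻ o, (o.2 i : ℝ≥0∞) ∂(robustMechanism M O δ τ c b) ∂(Measure.pi F) +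
        ENNReal.ofReal η := fun i =>
    (lintegral_payment_le O hδ c hM hw hG hIR hH hζ hτ i).trans
      (by gcongr; exact hη (Fin.pos i).ne')
  refine (Finset.sum_le_sum fun i _ => h i).trans_eq ?_
  rw [Finset.sum_add_distrib, ENNReal.ofReal_mul (by positivity)]
  simp

end Revenue

/-! ### Approximate incentive compatibility. -/

section ApproximateIncentives

variable {n m k : ℕ} {p : ℝ≥0∞} [Fact (1 ≤ p)] {G : Fin n → Measure (Latent p k)}
  [∀ i, IsProbabilityMeasure (G i)] {M : Mechanism n m (Latent p k)} [IsMarkovKernel M]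
  {H : ℝ} {w : Fin n → Latent p k → Set (Fin m) → ℝ≥0}

theorem isApproxBIC_robustMechanism (O : LatentOracle G) {δ : ℝ} (hδ : 0 < δ)
    {τ : ℝ} {c : ℝ≥0} (hM : HasPaymentRule M) (hw : ∀ i, IsRegularValuation H (w i))
    (hG : ∀ i, ∀ a ∈ (G i).support, ∀ j, |a j| ≤ 1)
    (hIR : IsIR M w fun i => (G i).support) (hBIC : IsBIC M w G) (hc : H * (τ + δ) ≤ c)
    (hH : 0 ≤ H) {F : Fin n → Measure (Latent p k)} [∀ i, IsProbabilityMeasure (F i)] {ζ : ℝ}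
    (hζ : ∀ i, levyProkhorovDist (F i) (G i) ≤ ζ) (hτ : ζ < τ) {η μ : ℝ}
    (hη0 : 0 ≤ η) (hη : n ≠ 0 →
      3 * c + 2 * (n * (8 * (2 * H) * (1 + (k : ℝ) ^ (1 - 1 / p.toReal) / δ) * ζ)) ≤ η)
    (hμ0 : 0 ≤ μ) (hμ : k ≠ 0 → τ ≤ μ) :
    IsApproxBIC (robustMechanism M O δ τ c) w F η μ := by
  intro i r
  -- For `k = 0` the factor `k^(1/p)` in `μ` can vanish, so `τ ≤ μ` may fail; but the latent space
  -- is a single point and there is no misreport.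
  rcases eq_or_ne k 0 with hk | hk
  · subst hk
    have : {t : Latent p 0 | interimUtility (robustMechanism M O δ τ c) w F i t r - η ≤
        interimUtility (robustMechanism M O δ τ c) w F i t t} = Set.univ := by
      ext t
      have : r = t := by ext j; exact j.elim0
      subst this
      simpa using hη0
    rw [this, probReal_univ]
    linarith
  -- If `τ > 1`, then `μ > 1` and the claim is void. Otherwise types within `τ` of the support have
  -- coordinates of size at most `2`, which permits the payoff bound `2 * H`.
  · by_cases hτ1 : 1 < τ
    · have := hμ hk
      exact le_trans (by linarith) measureReal_nonneg
    · have hτ0 : 0 ≤ τ := (ENNReal.toReal_nonneg.trans (hζ i)).trans hτ.le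
      have h1 : 1 - μ ≤ (F i).real {a : Latent p k | dist a (O.nearest i a) ≤ τ} := by
        have h2 : (F i).real {a : Latent p k | dist a (O.nearest i a) ≤ τ}ᶜ ≤ τ :=
          ENNReal.toReal_le_of_le_ofReal hτ0 (measure_far_le O i ((hζ i).trans_lt hτ))
        rw [probReal_compl_eq_one_sub (O.measurableSet_dist_nearest_le i τ)] at h2
        linarith [hμ hk]
      refine h1.trans (measureReal_mono fun t ht => ?_)
      have ht' : dist t (O.nearest i t) ≤ τ := ht
      have hD : ∀ j, |t j| ≤ 2 := fun j => by
        have h2 := hG i _ (O.nearest_mem i t) j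
        have h3 := abs_sub_apply_le_dist t (O.nearest i t) j
        have h4 := abs_add_le (t j - O.nearest i t j) (O.nearest i t j)
        rw [sub_add_cancel] at h4
        linarith
      have := interimUtility_robustMechanism_le O hδ hM hw hG hIR hBIC hc hζ hD
        (B := 2 * H) (by positivity) (by linarith) (by linarith) ht' r
      change _ - η ≤ _
      linarith [hη (Fin.pos i).ne']

end ApproximateIncentives

end

end LatentMechanism

/-! ### Choice of the parameters. -/

theorem mainTheorem4 :
    ∃ C : ℝ, 0 < C ∧
      ∀ (n m d k : ℕ) (p : ℝ≥0∞) [Fact (1 ≤ p)] (A : Matrix (Fin d) (Fin k) ℝ)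
        (L ζ δ : ℝ), 0 ≤ L → 0 ≤ ζ → 0 < δ →
      ∃ P : (Fin n → LatentMechanism.Latent p k) → LatentMechanism.OracleProgram n m p k,
      ∀ (v : Fin n → (Fin d → ℝ) → Set (Fin m) → ℝ≥0),
        (∀ i, LatentMechanism.IsLipschitzValuation L (v i)) →
        (∀ i S, v i 0 S = 0) →
        (∀ i t, v i t ∅ = 0) →
      ∀ (Fhat F : Fin n → Measure (LatentMechanism.Latent p k))
        [∀ i, IsProbabilityMeasure (Fhat i)] [∀ i, IsProbabilityMeasure (F i)],
        (∀ i, ∀ z ∈ (Fhat i).support, ∀ j, z j ∈ Set.Icc (0 : ℝ) 1) →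
        (∀ i, levyProkhorovDist (F i) (Fhat i) ≤ ζ) →
      ∀ (Mhat : LatentMechanism.Mechanism n m (LatentMechanism.Latent p k)) [IsMarkovKernel Mhat],
        LatentMechanism.HasPaymentRule Mhat →
        LatentMechanism.IsIR Mhat (fun i => LatentMechanism.latentValuation p A (v i))
          (fun i => (Fhat i).support) →
        LatentMechanism.IsBIC Mhat (fun i => LatentMechanism.latentValuation p A (v i)) Fhat →
      ∀ O : LatentMechanism.LatentOracle Fhat,
      ∃ Mt : LatentMechanism.Mechanism n m (LatentMechanism.Latent p k),
        IsMarkovKernel Mt ∧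
        LatentMechanism.IsImplementedBy Mt P Mhat O ∧
        (∀ K : Set (LatentMechanism.Allocation n m), IsLowerSet K →
          (∀ b, ∀ᵐ o ∂(Mhat b), o.1 ∈ K) → ∀ b, ∀ᵐ o ∂(Mt b), o.1 ∈ K) ∧
        ∃ η μ : ℝ,
          η = C * (k * L * LatentMechanism.maxEntry A *
            (δ + n * (1 + (k : ℝ) ^ (1 - 1 / p.toReal) / δ) * ζ)) ∧
          μ = C * (ζ + δ * (k : ℝ) ^ (1 / p.toReal)) ∧
          LatentMechanism.IsIR Mt (fun i => LatentMechanism.latentValuation p A (v i))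
            (fun _ => Set.univ) ∧
          LatentMechanism.IsApproxBIC Mt (fun i => LatentMechanism.latentValuation p A (v i))
            F η μ ∧
          LatentMechanism.revenue Mhat Fhat ≤
            LatentMechanism.revenue Mt F + ENNReal.ofReal (C * (n * η)) := by
  open LatentMechanism in
  -- With `X = n H (1 + Λ) ζ`, the incentive bound is at most `6 H δ + 35 X` and the revenue loss
  -- per bidder at most `3 H δ + 10 X`; `40` leaves room.
  refine ⟨40, by norm_num, fun n m d k p _ A L ζ δ hL hζ0 hδ => ?_⟩
  set H : ℝ := k * L * maxEntry A with hH
  have hH0 : 0 ≤ H := mul_nonneg (by positivity) (maxEntry_nonneg A)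
  set Λ : ℝ := (k : ℝ) ^ (1 - 1 / p.toReal) / δ with hΛ
  have hΛ0 : 0 ≤ Λ := by positivity
  -- This is `H * (τ + δ)` with `τ = ζ + δ`. The extra `δ` in `τ` makes `ζ < τ` strict, as the
  -- Prokhorov comparison requires, also when `ζ = 0`.
  set c : ℝ≥0 := Real.toNNReal (H * (ζ + δ + δ)) with hc
  have hcH : (c : ℝ) = H * (ζ + δ + δ) := Real.coe_toNNReal _ (by positivity)
  refine ⟨robustProgram m δ (ζ + δ) c, fun v hv hv0 hve Fhat F _ _ hsupp hF Mhat _ hM hIR hBIC O =>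
    ⟨robustMechanism Mhat O δ (ζ + δ) c, inferInstance,
      isImplementedBy_robustProgram Mhat O δ (ζ + δ) c,
      fun K hK h b => robustMechanism_ae_mem_of_isLowerSet O δ (ζ + δ) c hK h b,
      _, _, rfl, rfl, ?_⟩⟩
  have hw : ∀ i, IsRegularValuation H (latentValuation p A (v i)) := fun i =>
    isRegularValuation_latentValuation p hL A (hv i) (hv0 i) (hve i)
  have hG : ∀ i, ∀ a ∈ (Fhat i).support, ∀ j, |a j| ≤ 1 := fun i a ha j => by
    have := hsupp i a ha j
    rw [abs_of_nonneg this.1]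
    exact this.2
  have hτ : ζ < ζ + δ := by linarith
  have hΛζ : 0 ≤ H * ((1 + Λ) * ζ) := by positivity
  -- The terms `H * ζ` coming from `c` and `τ` carry no factor `n`, so they are absorbed into the
  -- transfer error only when there is a bidder.
  have hn : n ≠ 0 → H * ζ ≤ n * (H * ((1 + Λ) * ζ)) := fun hn => by
    have h1 : (1 : ℝ) ≤ n := by exact_mod_cast Nat.one_le_iff_ne_zero.2 hn
    have h2 : H * ζ ≤ H * ((1 + Λ) * ζ) :=
      mul_le_mul_of_nonneg_left (by nlinarith) hH0
    nlinarith
  have hHδ : 0 ≤ H * δ := by positivity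
  have hη : 40 * (H * (δ + n * (1 + Λ) * ζ)) =
      40 * (H * δ) + 40 * (n * (H * ((1 + Λ) * ζ))) := by ring
  have hnn : 0 ≤ n * (H * ((1 + Λ) * ζ)) := by positivity
  refine ⟨isIR_robustMechanism O hδ (ζ + δ) hM hw hG hIR hcH.ge,
    isApproxBIC_robustMechanism O hδ hM hw hG hIR hBIC hcH.ge hH0 hF hτ (by positivity)
      (fun h => ?_) (by positivity) (fun hk => ?_), ?_⟩
  · rw [hη, hcH]
    have h1 : 2 * (n * (8 * (2 * H) * (1 + Λ) * ζ)) = 32 * (n * (H * ((1 + Λ) * ζ))) := by ring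
    rw [h1]
    linarith [hn h]
  · have hk1 : (1 : ℝ) ≤ (k : ℝ) ^ (1 / p.toReal) :=
      Real.one_le_rpow (by exact_mod_cast Nat.one_le_iff_ne_zero.2 hk) (by positivity)
    nlinarith
  · refine (revenue_le_revenue_robustMechanism_add O hδ c hM hw hG hIR hH0 hF hτ
      (η := 40 * (H * (δ + n * (1 + Λ) * ζ))) fun h => ?_).trans ?_
    · rw [hη, hcH]
      have h1 : n * (8 * H * (1 + Λ) * ζ) = 8 * (n * (H * ((1 + Λ) * ζ))) := by ring
      rw [h1]
      linarith [hn h]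
    · refine add_le_add le_rfl (ENNReal.ofReal_le_ofReal ?_)
      rw [hη]
      nlinarith [mul_nonneg (Nat.cast_nonneg (α := ℝ) n) hHδ,
        mul_nonneg (Nat.cast_nonneg (α := ℝ) n) hnn]
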